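/- **Setting.** Let $\mu$ be the surface measure on $\mathbb S^2\subset\mathbb R^3$ ($\mu(\mathbb S^2)=4\pi$), $\langle f,g\rangle=\int_{\mathbb S^2} f\,\overline g\,d\mu$, and let $Y_\ell^m$ ($\ell\ge 0$, $|m|\le\ell$) be the usual orthonormal spherical harmonics, $Y_\ell^m(\theta,\phi)=\sqrt{\frac{2\ell+1}{4\pi}\frac{(\ell-m)!}{(\ell+m)!}}\,P_\ell^m(\cos\theta)\,e^{im\phi}$, with $P_\ell^m$ the associated Legendre functions (with the factor $(-1)^m$). For $f\in L^1(\mathbb R)$ put $\hat f(\xi)=\int_{\mathbb R} f(x)e^{-2\pi i x\xi}\,dx$, and for $h\in\ell^1(\mathbb Z)$ put $\hat h(\xi)=\sum_{k\in\mathbb Z}h_k e^{-2\pi i k\xi}$. A family $x_1,\dots,x_N\in\mathbb S^2$ is a spherical $t$-design if $\frac1N\sum_{i=1}^N p(x_i)=\frac1{4\pi}\int_{\mathbb S^2}p\,d\mu$ for all polynomials $p$ in three variables of total degree at most $t$. Let $\Psi=\{\alpha;\beta_1,\dots,\beta_n\}\subset L^1(\mathbb R)$ and $\eta=\{a;b_1,\dots,b_n\}\subset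 \ell^1(\mathbb Z)$ (complex valued) satisfy $$\hat\alpha(2\xi)=\hat a(\xi)\hat\alpha(\xi),\qquad \hat\beta_s(2\xi)=\hat b_s(\xi)\hat\alpha(\xi)\qquad(\xi\in\mathbb R,\ 1\le s\le n),$$ and let $\hat\alpha$ be supported, on the half-line $[0,\infty)$, in $[0,\frac12]$, that is, $\operatorname{supp}\hat\alpha\cap[0,\infty)\subseteq[0,\frac12]$. Fix $J_0\in\mathbb Z$. For every integer $j\ge J_0$ let $t_j\ge1$ be an integer, with $t_{j+1}=2t_j$, and let $x_{j,1},\dots,x_{j,N_j}\in\mathbb S^2$ be a spherical $t_j$-design. With the quadrature weights $w_{j,k}=4\pi/N_j$ define, for $j\ge J_0$, $$\varphi_{j,k}=\sqrt{w_{j,k}}\sum_{\ell=0}^\infty\sum_{m=-\ell}^{\ell}\hat\alpha\Big(\frac{\ell}{t_j}\Big)\overline{Y_\ell^m(x_{j,k})}\,Y_\ell^m,\quad 1\le k\le N_j,$$ $$\psi^{(s)}_{j,k}=\sqrt{w_{j+1,k}}\sum_{\ell=0}^\infty\sum_{m=-\ell}^{\ell}\hat\beta_s\Big(\frac{\ell}{t_j}\Big)\overline{Y_\ell^m(x_{j+1,k})}\,Y_\ell^m,\quad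 1\le k\le N_{j+1},\ 1\le s\le n,$$ and let $\mathcal F_J(\Psi,\mathcal Q)=\{\varphi_{J,k}\}_k\cup\{\psi^{(s)}_{j,k}\}_{j\ge J,\,k,\,s}$ be the semi-discrete spherical framelet system starting at scale $J\ge J_0$. **Theorem.** The following are equivalent. (i) For all $J\ge J_0$ the system $\mathcal F_J(\Psi,\mathcal Q)$ is a tight frame for $L^2(\mathbb S^2)$, that is, for all $f\in L^2(\mathbb S^2)$, $$f=\sum_{k=1}^{N_J}\langle f,\varphi_{J,k}\rangle\varphi_{J,k}+\sum_{j=J}^\infty\sum_{k=1}^{N_{j+1}}\sum_{s=1}^n\langle f,\psi^{(s)}_{j,k}\rangle\psi^{(s)}_{j,k}\quad\text{in }L^2(\mathbb S^2).$$ (ii) For all integers $\ell\ge0$, $$\lim_{j\to\infty}\Big|\hat\alpha\Big(\frac{\ell}{t_j}\Big)\Big|=1,\qquad(\ast)$$ and for all $\ell\ge0$ and $j\ge J_0$, $$\Big|\hat\alpha\Big(\frac{\ell}{t_{j+1}}\Big)\Big|^2=\Big|\hat\alpha\Big(\frac{\ell}{t_j}\Big)\Big|^2+\sum_{s=1}^n\Big|\hat\beta_s\Big(\frac{\ell}{t_j}\Big)\Big|^2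 .$$ (iii) $(\ast)$ holds for all $\ell\ge0$, and for all $j\ge J_0+1$ and all $\ell\ge0$ with $\hat\alpha(\ell/t_j)\ne0$, $$\Big|\hat a\Big(\frac{\ell}{t_j}\Big)\Big|^2+\sum_{s=1}^n\Big|\hat b_s\Big(\frac{\ell}{t_j}\Big)\Big|^2=1 .$$ -/

import Mathlib

open MeasureTheory Filter Topology
open scoped FourierTransform ComplexConjugate Nat

noncomputable section

namespace SphFramelet

/-- The unit sphere `𝕊²` of Euclidean `ℝ³`. -/
abbrev S2 : Type := Metric.sphere (0 : EuclideanSpace ℝ (Fin 3)) 1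

/-- The surface measure on `𝕊²`, of total mass `4π`. -/
def surf : Measure S2 := (volume : Measure (EuclideanSpace ℝ (Fin 3))).toSphere

/-- The Legendre polynomial `P_ℓ(z) = (1 / (2^ℓ ℓ!)) (d/dz)^ℓ (z² - 1)^ℓ`. -/
def legendre (l : ℕ) : Polynomial ℝ :=
  Polynomial.C (1 / (2 ^ l * (l ! : ℝ))) *
    Polynomial.derivative^[l] ((Polynomial.X ^ 2 - 1) ^ l)

/-- The associated Legendre function of nonnegative order,
`P_ℓ^m(z) = (-1)^m (1 - z²)^{m/2} (d/dz)^m P_ℓ(z)` for `z ∈ [-1, 1]`. -/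
def assocLegendreNat (l m : ℕ) (z : ℝ) : ℝ :=
  (-1) ^ m * Real.sqrt (1 - z ^ 2) ^ m *
    (Polynomial.derivative^[m] (legendre l)).eval z

/-- The associated Legendre function of order `m ∈ ℤ`, `|m| ≤ ℓ`, with the convention
`P_ℓ^{-m} = (-1)^m ((ℓ - m)! / (ℓ + m)!) P_ℓ^m` for negative orders. -/
def assocLegendre (l : ℕ) (m : ℤ) (z : ℝ) : ℝ :=
  if 0 ≤ m then assocLegendreNat l m.natAbs z
  else (-1) ^ m.natAbs * (((l - m.natAbs)! : ℝ) / ((l + m.natAbs)! : ℝ)) *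
    assocLegendreNat l m.natAbs z

/-- The spherical harmonic `Y_ℓ^m` (`|m| ≤ ℓ`) at
`x = (sin θ cos φ, sin θ sin φ, cos θ)`; here `cos θ = x₃` and `φ` is the argument of
`x₁ + i x₂`. At the poles, where `φ` is arbitrary, the value does not depend on `φ`. -/
def sphHarm (l : ℕ) (m : ℤ) (x : S2) : ℂ :=
  (Real.sqrt ((2 * l + 1) / (4 * Real.pi) *
      ((((l : ℤ) - m).toNat ! : ℝ) / (((l : ℤ) + m).toNat ! : ℝ))) : ℂ) *
    (assocLegendre l m (x.1 2) : ℂ) *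
    Complex.exp (Complex.I * m * (Complex.arg ((x.1 0 : ℂ) + (x.1 1 : ℂ) * Complex.I) : ℂ))

/-- `x₁, …, x_N ∈ 𝕊²` form a spherical `t`-design: the average over the points of every
polynomial in three variables of total degree at most `t` is its average over `𝕊²`. -/
def IsSphericalDesign (t : ℕ) {N : ℕ} (x : Fin N → S2) : Prop :=
  ∀ p : MvPolynomial (Fin 3) ℝ, p.totalDegree ≤ t →
    (1 / (N : ℝ)) * ∑ i, MvPolynomial.eval (fun c => (x i).1 c) p =
      (1 / surf.real Set.univ) * ∫ y, MvPolynomial.eval (fun c => y.1 c) p ∂surf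

/-- A quadrature rule on `𝕊²`: finitely many points with real weights. -/
structure QuadRule where
  /-- number of points -/
  N : ℕ
  /-- the points -/
  pts : Fin N → S2
  /-- the weights -/
  wt : Fin N → ℝ

/-- The equal weight rule with weights `4π / N` at the points `x₁, …, x_N`. -/
def equalWeightRule {N : ℕ} (x : Fin N → S2) : QuadRule where
  N := N
  pts := x
  wt := fun _ => 4 * Real.pi / N

/-- The Fourier series `ĥ(ξ) = ∑ₖ hₖ e^{-2πikξ}` of a filter `h ∈ ℓ¹(ℤ)`. -/
def filterHat (h : ℤ → ℂ) (ξ : ℝ) : ℂ :=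
  ∑' k : ℤ, h k * Complex.exp (-(2 * Real.pi * Complex.I * k * ξ))

/-- The function
`x ↦ √w_k ∑_{ℓ ≥ 0} ∑_{|m| ≤ ℓ} ĝ(ℓ / t) conj(Y_ℓ^m(x_k)) Y_ℓ^m(x)` on `𝕊²` attached to a
generator `g`, a scale `t` and the `k`-th node of a quadrature rule. -/
def framelet (g : ℝ → ℂ) (t : ℕ) (Q : QuadRule) (k : Fin Q.N) (x : S2) : ℂ :=
  (Real.sqrt (Q.wt k) : ℂ) *
    ∑' l : ℕ, ∑ m ∈ Finset.Icc (-(l : ℤ)) (l : ℤ),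
      𝓕 g ((l : ℝ) / (t : ℝ)) * conj (sphHarm l m (Q.pts k)) * sphHarm l m x

/-- The low-pass framelets `φ_{j,k}`. -/
def phi (α : ℝ → ℂ) (t : ℤ → ℕ) (Q : ℤ → QuadRule) (j : ℤ) (k : Fin (Q j).N) : S2 → ℂ :=
  framelet α (t j) (Q j) k

/-- The high-pass framelets `ψ_{j,k}^{(s)}`; their nodes are those of level `j + 1`. -/
def psi {n : ℕ} (β : Fin n → ℝ → ℂ) (t : ℤ → ℕ) (Q : ℤ → QuadRule) (s : Fin n) (j : ℤ)
    (k : Fin (Q (j + 1)).N) : S2 → ℂ :=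
  framelet (β s) (t j) (Q (j + 1)) k

/-- The inner product `⟨f, g⟩ = ∫ f conj(g)` of `L²(𝕊²)`. -/
def ip (f g : S2 → ℂ) : ℂ := ∫ x, f x * conj (g x) ∂surf

/-- The partial sum
`∑ₖ ⟨f, φ_{J,k}⟩ φ_{J,k} + ∑_{j=J}^{J+M-1} ∑ₖ ∑ₛ ⟨f, ψ_{j,k}^{(s)}⟩ ψ_{j,k}^{(s)}`
of the framelet expansion of `f` starting at scale `J`. -/
def partialExpansion {n : ℕ} (α : ℝ → ℂ) (β : Fin n → ℝ → ℂ) (t : ℤ → ℕ) (Q : ℤ → QuadRule)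
    (J : ℤ) (f : S2 → ℂ) (M : ℕ) (x : S2) : ℂ :=
  ∑ k, ip f (phi α t Q J k) * phi α t Q J k x +
    ∑ i ∈ Finset.range M, ∑ k, ∑ s,
      ip f (psi β t Q s (J + i) k) * psi β t Q s (J + i) k x

/-- The framelet system `F_J(Ψ, Q)` is a tight frame for `L²(𝕊²)`: every `f ∈ L²(𝕊²)` is the
`L²`-limit of the partial sums of its framelet expansion starting at scale `J`. -/
def IsTightFrameletSystem {n : ℕ} (α : ℝ → ℂ) (β : Fin n → ℝ → ℂ) (t : ℤ → ℕ)
    (Q : ℤ → QuadRule) (J : ℤ) : Prop :=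
  ∀ f : S2 → ℂ, MemLp f 2 surf →
    Tendsto (fun M : ℕ => eLpNorm (fun x => f x - partialExpansion α β t Q J f M x) 2 surf)
      atTop (𝓝 0)

/-- `lim_{j → ∞} |α̂(ℓ / t_j)| = 1` for every degree `ℓ`. -/
def LimitCondition (α : ℝ → ℂ) (t : ℤ → ℕ) : Prop :=
  ∀ l : ℕ, Tendsto (fun j : ℤ => ‖𝓕 α ((l : ℝ) / (t j : ℝ))‖) atTop (𝓝 1)

end SphFramelet

end

/-! Everything is diagonal in the spherical harmonics. Suppose the samples `ĝ(l/t)` vanish unless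
`2l ≤ T`. For harmonics `Y`, `Y'` of such degrees, `Y conj Y'` is a polynomial of degree at most
`T`, so a `T`-design integrates it exactly and reproduces orthonormality. Hence the framelets of `g`
together act as the operator multiplying the degree-`l` part of `f` by `|ĝ(l/t)|²`
(`sum_ip_framelet_mul`). For `α` the support in `[0, 1/2]` gives `2l ≤ t_j`. For `β_s` the
refinement equation puts a factor `α̂(l/t_{j+1})` in `β̂_s(l/t_j)`, so `2l ≤ t_{j+1}`, which matches
the nodes of level `j + 1`.

A partial expansion is therefore a multiplier, increasing in the number of scales, and the system is
tight iff the multiplier tends to `1` in every degree (`isTightFrameletSystem_iff`). Comparing the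
starting scales `J` and `J + 1` yields the two-scale identity of (ii); conversely that identity
telescopes the multiplier to `|α̂(l/t_{J+M})|²`. The refinement equations at `l/t_{j+1}` turn (ii)
into (iii) times `|α̂(l/t_{j+1})|²`, which says nothing where that factor vanishes.

The remaining work shows that the explicit `Y_l^m` form a Hilbert basis. Orthonormality comes from
rotations and the Legendre equation, completeness from Stone–Weierstrass (`harmSpan_dense`).
Integrals over the sphere are extracted from Gaussian integrals in polar coordinates. -/

noncomputable section

namespace SphFramelet

/-! ### Orthogonality and norms of the associated Legendre functions -/

section Legendre

open Polynomial

/-- The integral of a real polynomial over `[-1, 1]`. -/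
def segmentIntegral (p : ℝ[X]) : ℝ := ∫ z in (-1 : ℝ)..1, p.eval z

lemma segmentIntegral_add (p q : ℝ[X]) :
    segmentIntegral (p + q) = segmentIntegral p + segmentIntegral q := by
  simp only [segmentIntegral, eval_add]
  exact intervalIntegral.integral_add (p.continuous.intervalIntegrable _ _)
    (q.continuous.intervalIntegrable _ _)

lemma segmentIntegral_C_mul (c : ℝ) (p : ℝ[X]) :
    segmentIntegral (C c * p) = c * segmentIntegral p := by
  simp [segmentIntegral]

lemma segmentIntegral_derivative (p : ℝ[X]) :
    segmentIntegral (derivative p) = p.eval 1 - p.eval (-1) :=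
  intervalIntegral.integral_eq_sub_of_hasDerivAt (fun z _ => p.hasDerivAt z)
    ((derivative p).continuous.intervalIntegrable _ _)

/-- The function `v = (x² - 1)^l` satisfies `(x² - 1) v' = 2l x v`; differentiate this `k + 1`
times. -/
lemma iterate_derivative_sq_sub_one_pow (l k : ℕ) :
    (X ^ 2 - 1 : ℝ[X]) * derivative^[k + 2] ((X ^ 2 - 1) ^ l)
      + C (2 * (k + 1) - 2 * l : ℝ) * X * derivative^[k + 1] ((X ^ 2 - 1) ^ l)
      + C ((k + 1) * k - 2 * l * (k + 1) : ℝ) * derivative^[k] ((X ^ 2 - 1) ^ l) = 0 := by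
  induction k with
  | zero =>
    have h : (X ^ 2 - 1 : ℝ[X]) * derivative ((X ^ 2 - 1) ^ l)
        = C (2 * l : ℝ) * X * (X ^ 2 - 1) ^ l := by
      cases l with
      | zero => simp
      | succ l =>
        simp only [derivative_pow, derivative_sub, derivative_X, derivative_one, map_mul,
          map_natCast, map_ofNat]
        simp
        ring
    have h' := congrArg derivative h
    rw [derivative_mul, mul_assoc (C _), derivative_C_mul, derivative_mul (f := X)] at h'
    simp only [derivative_sub, derivative_X_pow, derivative_X, derivative_one] at h'
    simp only [Function.iterate_succ, Function.iterate_zero, Function.comp_apply, id,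
      map_sub, map_mul, map_add, map_natCast, map_ofNat, map_one, map_zero, Nat.cast_zero,
      Nat.cast_ofNat] at h' ⊢
    linear_combination h'
  | succ k ih =>
    simp only [Function.iterate_succ_apply'] at ih ⊢
    generalize derivative^[k] ((X ^ 2 - 1 : ℝ[X]) ^ l) = v at ih ⊢
    have h' := congrArg derivative ih
    rw [derivative_add, derivative_add, derivative_mul, mul_assoc (C _), derivative_C_mul,
      derivative_mul (f := X), derivative_C_mul] at h'
    simp only [derivative_sub, derivative_X_pow, derivative_X, derivative_one,
      derivative_zero] at h'
    simp only [map_sub, map_mul, map_add, map_natCast, map_ofNat, map_one, Nat.cast_add,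
      Nat.cast_one, Nat.cast_ofNat] at h' ⊢
    linear_combination h'

/-- The differential equation of the associated Legendre functions. -/
lemma legendre_differential_equation (l m : ℕ) :
    (1 - X ^ 2 : ℝ[X]) * derivative^[m + 2] (legendre l)
      - C (2 * (m + 1) : ℝ) * X * derivative^[m + 1] (legendre l)
      + C ((l - m) * (l + m + 1) : ℝ) * derivative^[m] (legendre l) = 0 := by
  have h := iterate_derivative_sq_sub_one_pow l (m + l)
  simp only [legendre, iterate_derivative_C_mul, ← Function.iterate_add_apply]
  rw [show m + 2 + l = m + l + 2 by ring, show m + 1 + l = m + l + 1 by ring]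
  simp only [map_sub, map_mul, map_add, map_natCast, map_ofNat, map_one, Nat.cast_add] at h ⊢
  linear_combination (-C (1 / (2 ^ l * (l ! : ℝ)))) * h

/-- The pairing of the associated Legendre functions of order `m` and degrees `l`, `l'`. -/
def legendrePairing (m l l' : ℕ) : ℝ :=
  segmentIntegral ((1 - X ^ 2) ^ m * derivative^[m] (legendre l) * derivative^[m] (legendre l'))

lemma legendrePairing_comm (m l l' : ℕ) : legendrePairing m l l' = legendrePairing m l' l := by
  simp only [legendrePairing]
  congr 1
  ring

/-- Integration by parts against the differential equation in self-adjoint form; the boundary term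
carries `(1 - x²)^(m+1)` and vanishes at `±1`. -/
lemma legendrePairing_succ (m l l' : ℕ) :
    legendrePairing (m + 1) l l' = (l - m) * (l + m + 1) * legendrePairing m l l' := by
  set u := derivative^[m] (legendre l) with hu
  set v := derivative^[m] (legendre l') with hv
  have key : derivative ((1 - X ^ 2) ^ (m + 1) * derivative u * v)
      = (1 - X ^ 2) ^ (m + 1) * derivative u * derivative v
        + C (-((l - m) * (l + m + 1)) : ℝ) * ((1 - X ^ 2) ^ m * u * v) := by
    have h := legendre_differential_equation l m
    rw [Function.iterate_succ_apply', Function.iterate_succ_apply', ← hu] at h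
    simp only [derivative_mul, derivative_pow, derivative_one, derivative_X,
      map_neg, map_sub, map_mul, map_add, map_natCast, map_ofNat, map_one] at h ⊢
    simp
    linear_combination (1 - X ^ 2) ^ m * v * h
  have h := segmentIntegral_derivative ((1 - X ^ 2) ^ (m + 1) * derivative u * v)
  rw [key, segmentIntegral_add, segmentIntegral_C_mul] at h
  simp only [eval_mul, eval_pow, eval_sub, eval_one, eval_X] at h
  norm_num at h
  simp only [legendrePairing, Function.iterate_succ_apply', ← hu, ← hv]
  linarith

lemma legendrePairing_eq_zero {l l' : ℕ} (h : l ≠ l') (m : ℕ) : legendrePairing m l l' = 0 := by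
  induction m with
  | zero =>
    -- The order-one pairing is symmetric, so the recursion from either side gives the same value,
    -- while the eigenvalues `l(l+1)` and `l'(l'+1)` differ.
    have h1 := legendrePairing_succ 0 l l'
    have h2 := legendrePairing_succ 0 l' l
    rw [legendrePairing_comm, legendrePairing_comm 0] at h2
    have h3 : ((l : ℝ) - l') * (l + l' + 1) * legendrePairing 0 l l' = 0 := by
      push_cast at h1 h2
      linear_combination h2 - h1
    have h4 : (l : ℝ) - l' ≠ 0 := sub_ne_zero.2 (by exact_mod_cast h)
    have h5 : (l : ℝ) + l' + 1 ≠ 0 := by positivity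
    simpa [h4, h5] using h3
  | succ m ih => rw [legendrePairing_succ, ih, mul_zero]

lemma segmentIntegral_one_sub_sq_pow (l : ℕ) :
    segmentIntegral ((1 - X ^ 2) ^ l) * (2 * l + 1)! = 2 * (2 ^ l * (l ! : ℝ)) ^ 2 := by
  induction l with
  | zero => simp [segmentIntegral]; norm_num
  | succ l ih =>
    -- This primitive vanishes at `±1`, so integrating gives the reduction formula from exponent `l
    -- + 1` to `l`.
    have key : derivative (X * (1 - X ^ 2) ^ (l + 1) : ℝ[X])
        = C (2 * l + 3 : ℝ) * (1 - X ^ 2) ^ (l + 1)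
          + C (-(2 * l + 2) : ℝ) * (1 - X ^ 2) ^ l := by
      simp only [derivative_mul, derivative_pow, derivative_X,
        map_neg, map_mul, map_add, map_natCast, map_ofNat]
      simp
      ring
    have h := segmentIntegral_derivative (X * (1 - X ^ 2) ^ (l + 1))
    rw [key, segmentIntegral_add, segmentIntegral_C_mul, segmentIntegral_C_mul] at h
    norm_num at h
    rw [show 2 * (l + 1) + 1 = (2 * l + 1) + 1 + 1 by ring, Nat.factorial_succ,
      Nat.factorial_succ (2 * l + 1), Nat.factorial_succ l]
    push_cast
    linear_combination (2 * l + 2) * (2 * l + 1)! * h + (2 * l + 2 : ℝ) ^ 2 * ih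

lemma coeff_iterate_derivative_legendre {l m : ℕ} (h : m ≤ l) :
    (derivative^[m] (legendre l)).coeff (l - m)
      = 1 / (2 ^ l * (l ! : ℝ)) * ((2 * l).descFactorial (l + m) : ℝ) := by
  have hmonic : ((X ^ 2 - 1 : ℝ[X]) ^ l).coeff (2 * l) = 1 := by
    have h1 : (X ^ 2 - 1 : ℝ[X]).Monic := by monicity!
    have h2 : (X ^ 2 - 1 : ℝ[X]).natDegree = 2 := by compute_degree!
    have h3 := (h1.pow l).coeff_natDegree
    rwa [h1.natDegree_pow, h2, mul_comm] at h3
  rw [legendre, iterate_derivative_C_mul, ← Function.iterate_add_apply, coeff_C_mul,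
    coeff_iterate_derivative, show l - m + (m + l) = 2 * l by omega, hmonic, add_comm m l]
  simp

lemma natDegree_iterate_derivative_legendre_le (l m : ℕ) :
    (derivative^[m] (legendre l)).natDegree ≤ l - m := by
  have h1 : ((X ^ 2 - 1 : ℝ[X]) ^ l).natDegree ≤ 2 * l := by
    rw [mul_comm]
    exact natDegree_pow_le_of_le l (by compute_degree)
  rw [legendre, iterate_derivative_C_mul, ← Function.iterate_add_apply]
  refine (natDegree_C_mul_le _ _).trans ((natDegree_iterate_derivative _ _).trans ?_)
  omega

lemma natDegree_iterate_derivative_legendre {l m : ℕ} (h : m ≤ l) :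
    (derivative^[m] (legendre l)).natDegree = l - m := by
  refine le_antisymm (natDegree_iterate_derivative_legendre_le l m) (le_natDegree_of_ne_zero ?_)
  rw [coeff_iterate_derivative_legendre h]
  have : (2 * l).descFactorial (l + m) ≠ 0 := by
    rw [Ne, Nat.descFactorial_eq_zero_iff_lt]
    omega
  positivity

lemma legendrePairing_self_mul {l m : ℕ} (h : m ≤ l) :
    legendrePairing m l l * (l - m)! = (l + m)! * legendrePairing 0 l l := by
  induction m with
  | zero => simp [mul_comm]
  | succ m ih =>
    have ih := ih (by omega)
    obtain ⟨d, rfl⟩ : ∃ d, l = m + 1 + d := ⟨l - (m + 1), by omega⟩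
    rw [legendrePairing_succ, show m + 1 + d - (m + 1) = d by omega]
    rw [show m + 1 + d - m = d + 1 by omega, Nat.factorial_succ d] at ih
    rw [show m + 1 + d + (m + 1) = m + 1 + d + m + 1 by ring, Nat.factorial_succ (m + 1 + d + m)]
    push_cast at ih ⊢
    linear_combination ((m : ℝ) + 1 + d + m + 1) * ih

/-- At order `l` the derivative of `P_l` is a constant, so the pairing is an explicit integral;
`legendrePairing_self_mul` carries its value down to order `0`. -/
lemma legendrePairing_zero_self (l : ℕ) : legendrePairing 0 l l = 2 / (2 * l + 1) := by
  have h1 := legendrePairing_self_mul le_rfl (l := l)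
  have h2 : derivative^[l] (legendre l) = C (1 / (2 ^ l * (l ! : ℝ)) * ((2 * l)! : ℝ)) := by
    have h3 := coeff_iterate_derivative_legendre le_rfl (l := l)
    rw [← two_mul, Nat.descFactorial_self, Nat.sub_self] at h3
    rw [← h3]
    exact eq_C_of_natDegree_le_zero
      ((natDegree_iterate_derivative_legendre_le l l).trans (by simp))
  have h3 : legendrePairing l l l
      = (1 / (2 ^ l * (l ! : ℝ)) * ((2 * l)! : ℝ)) ^ 2 * segmentIntegral ((1 - X ^ 2) ^ l) := by
    rw [legendrePairing, h2, ← segmentIntegral_C_mul]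
    congr 1
    rw [map_pow]
    ring
  have h4 := segmentIntegral_one_sub_sq_pow l
  rw [← two_mul, h3, Nat.sub_self, Nat.factorial_zero] at h1
  rw [Nat.factorial_succ] at h4
  have h5 : ((2 * l)! : ℝ) ≠ 0 := by positivity
  push_cast at h4 h1
  rw [eq_div_iff (by positivity)]
  apply mul_left_cancel₀ h5
  rw [← mul_assoc, ← h1]
  field_simp
  linear_combination h4

lemma legendrePairing_self {l m : ℕ} (h : m ≤ l) :
    legendrePairing m l l = 2 / (2 * l + 1) * ((l + m)! / (l - m)!) := by
  have h1 := legendrePairing_self_mul h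
  rw [legendrePairing_zero_self] at h1
  have h5 : ((l - m)! : ℝ) ≠ 0 := by positivity
  rw [← mul_div_assoc, eq_div_iff h5, h1]
  ring

end Legendre

/-! ### Integration over the sphere -/

/-- Euclidean three-space. -/
abbrev E3 : Type := EuclideanSpace ℝ (Fin 3)

instance : IsFiniteMeasure surf := inferInstanceAs (IsFiniteMeasure (Measure.toSphere _))

/-- Polar coordinates. No integrability is required, since the product formula for Bochner integrals
holds unconditionally. -/
lemma integral_eq_integral_sphere_mul {f : E3 → ℂ} {h : S2 → ℂ} {g : ℝ → ℂ}
    (hf : ∀ (u : S2) (r : ℝ), 0 < r → f (r • u.1) = h u * g r) :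
    ∫ x, f x = (∫ u, h u ∂surf) * ∫ r in Set.Ioi (0 : ℝ), (r : ℂ) ^ 2 * g r := by
  have hdim : Module.finrank ℝ E3 - 1 = 2 := by simp
  calc ∫ x, f x = ∫ x : ({(0 : E3)}ᶜ : Set E3), f x.1 ∂(volume.comap Subtype.val) := by
        rw [integral_subtype_comap (measurableSet_singleton _).compl f,
          restrict_compl_singleton]
    _ = ∫ p : S2 × Set.Ioi (0 : ℝ), h p.1 * g p.2 ∂(surf.prod (.volumeIoiPow 2)) := by
        have := (volume : Measure E3).measurePreserving_homeomorphUnitSphereProd.integral_comp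
          (Homeomorph.measurableEmbedding _)
          (fun p : S2 × Set.Ioi (0 : ℝ) => h p.1 * g p.2)
        rw [hdim] at this
        rw [surf, ← this]
        refine integral_congr_ae (.of_forall fun x => ?_)
        have hx : 0 < ‖x.1‖ := norm_pos_iff.2 x.2
        dsimp only
        rw [homeomorphUnitSphereProd_apply_snd_coe, ← hf _ _ hx]
        congr 1
        simp [smul_smul, hx.ne']
    _ = (∫ u, h u ∂surf) * ∫ r : Set.Ioi (0 : ℝ), g r ∂(.volumeIoiPow 2) :=
        integral_prod_mul h fun r : Set.Ioi (0 : ℝ) => g r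
    _ = _ := by
        congr 1
        simp only [Measure.volumeIoiPow, ENNReal.ofReal]
        rw [integral_withDensity_eq_integral_smul,
          integral_subtype_comap measurableSet_Ioi fun a => Real.toNNReal (a ^ 2) • g a]
        · refine setIntegral_congr_fun measurableSet_Ioi fun x hx => ?_
          simp only [NNReal.smul_def, Real.coe_toNNReal _ (pow_nonneg (le_of_lt hx) _)]
          simp
        · exact (measurable_subtype_coe.pow_const _).real_toNNReal

lemma integral_sq_mul_exp_neg_sq :
    ∫ r in Set.Ioi (0 : ℝ), (r : ℂ) ^ 2 * Complex.exp (-(r : ℂ) ^ 2)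
      = (1 / 2 * Real.Gamma (3 / 2) : ℝ) := by
  have := integral_rpow_mul_exp_neg_rpow (p := 2) (q := 2) (by norm_num) (by norm_num)
  rw [show ((2 : ℝ) + 1) / 2 = 3 / 2 by norm_num] at this
  rw [← this, ← integral_complex_ofReal]
  refine setIntegral_congr_fun measurableSet_Ioi fun x hx => ?_
  simp

/-- Invariance is inherited from Lebesgue measure: extend `H` radially, weight it by a Gaussian, and
cancel the common nonzero radial integral. -/
lemma integral_surf_comp_linearIsometryEquiv (L : E3 ≃ₗᵢ[ℝ] E3) (H : E3 → ℂ) :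
    ∫ u, H (L u.1) ∂surf = ∫ u, H u.1 ∂surf := by
  have h1 := integral_eq_integral_sphere_mul
    (f := fun x => H (‖x‖⁻¹ • x) * Complex.exp (-(‖x‖ : ℂ) ^ 2)) (h := fun u => H u.1)
    (g := fun r => Complex.exp (-(r : ℂ) ^ 2)) fun u r hr => by
      have hu : ‖u.1‖ = 1 := by simp
      simp [norm_smul, hu, abs_of_pos hr, smul_smul, hr.ne']
  have h2 := integral_eq_integral_sphere_mul
    (f := fun x => H (‖L x‖⁻¹ • L x) * Complex.exp (-(‖L x‖ : ℂ) ^ 2)) (h := fun u => H (L u.1))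
    (g := fun r => Complex.exp (-(r : ℂ) ^ 2)) fun u r hr => by
      have hu : ‖u.1‖ = 1 := by simp
      simp only [map_smul]
      simp [norm_smul, hu, abs_of_pos hr, smul_smul, hr.ne']
  have h3 := L.measurePreserving.integral_comp L.toHomeomorph.measurableEmbedding
    (fun x => H (‖x‖⁻¹ • x) * Complex.exp (-(‖x‖ : ℂ) ^ 2))
  rw [h2, h1, integral_sq_mul_exp_neg_sq] at h3
  refine mul_right_cancel₀ ?_ h3
  have : Real.Gamma (3 / 2) ≠ 0 := (Real.Gamma_pos_of_pos (by norm_num)).ne'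
  exact_mod_cast mul_ne_zero (by norm_num) this

lemma integral_pow_mul_exp_neg_sq_line (k : ℕ) :
    ∫ x : ℝ, x ^ (2 * k) * Real.exp (-x ^ 2) = Real.Gamma (k + 1 / 2) := by
  have h := integral_comp_abs (f := fun x => x ^ (2 * k) * Real.exp (-x ^ 2))
  simp only [sq_abs, pow_mul] at h ⊢
  rw [h]
  have := integral_rpow_mul_exp_neg_rpow (p := 2) (q := 2 * k) (by norm_num) (by
    have : (0 : ℝ) ≤ k := by positivity
    linarith)
  rw [show ((2 : ℝ) * k + 1) / 2 = k + 1 / 2 by ring] at this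
  rw [mul_comm 2, ← eq_div_iff two_ne_zero, div_eq_inv_mul, ← one_div, ← this]
  refine setIntegral_congr_fun measurableSet_Ioi fun x hx => ?_
  have hx : 0 < x := hx
  simp only [Real.rpow_mul hx.le, Real.rpow_natCast, Real.rpow_two]

/-- The integral of `x₃^(2k) exp(-|x|²)` over space is computed twice, as a product of line
integrals and in polar coordinates. -/
lemma integral_surf_pow_even (k : ℕ) :
    ∫ u : S2, ((u.1 2 : ℝ) : ℂ) ^ (2 * k) ∂surf = ((4 * Real.pi / (2 * k + 1) : ℝ) : ℂ) := by
  have h1 := integral_eq_integral_sphere_mul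
    (f := fun x => ((x 2 ^ (2 * k) * Real.exp (-‖x‖ ^ 2) : ℝ) : ℂ))
    (h := fun u => ((u.1 2 : ℝ) : ℂ) ^ (2 * k))
    (g := fun r => ((r ^ (2 * k) * Real.exp (-r ^ 2) : ℝ) : ℂ)) fun u r hr => by
      have hu : ‖u.1‖ = 1 := by simp
      simp [norm_smul, hu, abs_of_pos hr]
      ring
  have h2 : ∫ x : E3, x 2 ^ (2 * k) * Real.exp (-‖x‖ ^ 2)
      = Real.pi * Real.Gamma (k + 1 / 2) := by
    have hv := (EuclideanSpace.volume_preserving_symm_measurableEquiv_toLp (Fin 3)).symm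
    rw [← hv.integral_comp (MeasurableEquiv.measurableEmbedding _)]
    have hg : ∫ x : ℝ, Real.exp (-x ^ 2) = √Real.pi := by
      simpa using integral_gaussian 1
    have hprod := integral_fintype_prod_volume_eq_prod (ι := Fin 3) (𝕜 := ℝ)
      (fun i x => (if i = 2 then x ^ (2 * k) else 1) * Real.exp (-x ^ 2))
    rw [Fin.prod_univ_three] at hprod
    have h1 : ∀ i ∈ ({0, 1} : Finset (Fin 3)), ∫ x : ℝ,
        (if i = 2 then x ^ (2 * k) else 1) * Real.exp (-x ^ 2) = √Real.pi := by
      simp [hg]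
    rw [h1 0 (by simp), h1 1 (by simp), Real.mul_self_sqrt Real.pi_pos.le] at hprod
    simp only [if_true, integral_pow_mul_exp_neg_sq_line] at hprod
    rw [← hprod]
    refine integral_congr_ae (.of_forall fun x => ?_)
    simp [EuclideanSpace.norm_sq_eq, Fin.sum_univ_three, Fin.prod_univ_three,
      Real.exp_add]
    ring
  have h3 : ∫ r in Set.Ioi (0 : ℝ), (r : ℂ) ^ 2 * ((r ^ (2 * k) * Real.exp (-r ^ 2) : ℝ) : ℂ)
      = ((1 / 2 * Real.Gamma (k + 3 / 2) : ℝ) : ℂ) := by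
    have := integral_rpow_mul_exp_neg_rpow (p := 2) (q := 2 * k + 2) (by norm_num) (by
      have : (0 : ℝ) ≤ k := by positivity
      linarith)
    rw [show ((2 : ℝ) * k + 2 + 1) / 2 = k + 3 / 2 by ring] at this
    rw [← this, ← integral_complex_ofReal]
    refine setIntegral_congr_fun measurableSet_Ioi fun x hx => ?_
    have hx : 0 < x := hx
    simp only [Real.rpow_add hx, Real.rpow_mul hx.le, Real.rpow_natCast, Real.rpow_two]
    push_cast
    ring
  rw [integral_complex_ofReal, h2, h3] at h1
  have hG : Real.Gamma (k + 3 / 2) = (k + 1 / 2) * Real.Gamma (k + 1 / 2) := by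
    rw [← Real.Gamma_add_one (by positivity)]
    congr 1
    ring
  have hpos : Real.Gamma (k + 1 / 2) ≠ 0 := (Real.Gamma_pos_of_pos (by positivity)).ne'
  have hne : ((1 / 2 * Real.Gamma (k + 3 / 2) : ℝ) : ℂ) ≠ 0 := by
    rw [hG]
    exact_mod_cast mul_ne_zero (by norm_num) (mul_ne_zero (by positivity) hpos)
  refine mul_right_cancel₀ hne (h1.symm.trans ?_)
  rw [← Complex.ofReal_mul, hG]
  congr 1
  field_simp
  ring

lemma integral_surf_pow_odd (k : ℕ) :
    ∫ u : S2, ((u.1 2 : ℝ) : ℂ) ^ (2 * k + 1) ∂surf = 0 := by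
  have h := integral_surf_comp_linearIsometryEquiv (LinearIsometryEquiv.neg ℝ)
    (fun x => ((x 2 : ℝ) : ℂ) ^ (2 * k + 1))
  simp only [LinearIsometryEquiv.coe_neg, PiLp.neg_apply, Complex.ofReal_neg,
    (odd_two_mul_add_one k).neg_pow, integral_neg] at h
  exact self_eq_neg.1 h.symm

lemma integrable_surf_of_continuous {F : Type*} [NormedAddCommGroup F] {f : S2 → F}
    (hf : Continuous f) : Integrable f surf :=
  hf.integrable_of_hasCompactSupport (HasCompactSupport.of_compactSpace f)

/-- Archimedes: the height function pushes the surface measure to `2π` times Lebesgue measure. -/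
lemma integral_surf_eval_height (p : Polynomial ℝ) :
    ∫ u : S2, ((p.eval (u.1 2) : ℝ) : ℂ) ∂surf
      = ((2 * Real.pi * ∫ z in (-1 : ℝ)..1, p.eval z : ℝ) : ℂ) := by
  have hc (q : Polynomial ℝ) : Continuous fun u : S2 => q.eval (u.1 2) :=
    q.continuous.comp (by fun_prop)
  induction p using Polynomial.induction_on' with
  | add p q hp hq =>
    simp only [Polynomial.eval_add, Complex.ofReal_add]
    have hi (q : Polynomial ℝ) : Integrable (fun u : S2 => ((q.eval (u.1 2) : ℝ) : ℂ)) surf :=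
      integrable_surf_of_continuous (Complex.continuous_ofReal.comp (hc q))
    rw [integral_add (hi p) (hi q), hp, hq,
      intervalIntegral.integral_add (p.continuous.intervalIntegrable _ _)
        (q.continuous.intervalIntegrable _ _)]
    push_cast
    ring
  | monomial k c =>
    simp only [Polynomial.eval_monomial, Complex.ofReal_mul, Complex.ofReal_pow]
    rw [integral_const_mul, intervalIntegral.integral_const_mul, integral_pow]
    rcases Nat.even_or_odd' k with ⟨i, rfl | rfl⟩
    · rw [integral_surf_pow_even, (odd_two_mul_add_one i).neg_pow]
      push_cast
      ring
    · rw [integral_surf_pow_odd]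
      have : Even (2 * i + 1 + 1) := ⟨i + 1, by ring⟩
      simp [this.neg_pow]

lemma surf_real_univ : surf.real Set.univ = 4 * Real.pi := by
  have h := integral_surf_pow_even 0
  simp only [mul_zero, pow_zero, integral_const, Nat.cast_zero, zero_add, div_one,
    Complex.real_smul, mul_one] at h
  exact Complex.ofReal_injective h

/-! ### Spherical harmonics in Cartesian coordinates -/

/-- The horizontal coordinate `x₁ + i x₂`. -/
def horiz (x : E3) : ℂ := (x 0 : ℂ) + (x 1 : ℂ) * Complex.I

/-- The azimuthal factor of order `m`: a power of `-(x₁ + i x₂)` or of `x₁ - i x₂`. -/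
def azimuthal (m : ℤ) (x : E3) : ℂ :=
  if 0 ≤ m then (-horiz x) ^ m.natAbs else conj (horiz x) ^ m.natAbs

/-- The normalization of the spherical harmonics of degree `l` and order `±k`. -/
def harmNorm (l k : ℕ) : ℝ :=
  Real.sqrt ((2 * l + 1) / (4 * Real.pi) * (((l - k)! : ℝ) / ((l + k)! : ℝ)))

/-- The extension of `Y_l^m` to a polynomial function on space. -/
def harmPoly (l : ℕ) (m : ℤ) (x : E3) : ℂ :=
  (harmNorm l m.natAbs : ℂ) *
    (((Polynomial.derivative^[m.natAbs] (legendre l)).eval (x 2) : ℝ) : ℂ) * azimuthal m x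

lemma sum_sq_sphere (u : S2) : u.1 0 ^ 2 + u.1 1 ^ 2 + u.1 2 ^ 2 = 1 := by
  have h : ‖u.1‖ ^ 2 = 1 := by simp
  rw [EuclideanSpace.norm_sq_eq, Fin.sum_univ_three] at h
  simpa using h

lemma horiz_mul_conj (u : S2) :
    horiz u.1 * conj (horiz u.1) = ((1 - u.1 2 ^ 2 : ℝ) : ℂ) := by
  have h := sum_sq_sphere u
  rw [Complex.mul_conj, Complex.normSq_apply]
  congr 1
  simp [horiz]
  linarith

lemma norm_horiz (u : S2) : ‖horiz u.1‖ = Real.sqrt (1 - u.1 2 ^ 2) := by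
  have h := horiz_mul_conj u
  rw [Complex.mul_conj, Complex.ofReal_inj, Complex.normSq_eq_norm_sq] at h
  rw [← h, Real.sqrt_sq (norm_nonneg _)]

/-- Since `x₁ + i x₂ = √(1 - x₃²) e^{iφ}`, the root in `P_l^m` and the phase combine into a power of
this number or of its conjugate. The sign `(-1)^m` is absorbed by the minus in `azimuthal` for `m ≥
0` and cancels for `m < 0`. -/
lemma sphHarm_eq_harmPoly {l : ℕ} {m : ℤ} (hm : m ∈ Finset.Icc (-(l : ℤ)) l) (u : S2) :
    sphHarm l m u = harmPoly l m u.1 := by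
  rw [Finset.mem_Icc] at hm
  have hpol := Complex.norm_mul_exp_arg_mul_I (horiz u.1)
  rw [norm_horiz] at hpol
  have harg : Complex.arg ((u.1 0 : ℂ) + (u.1 1 : ℂ) * Complex.I)
    = Complex.arg (horiz u.1) := rfl
  rw [sphHarm, harmPoly, azimuthal, assocLegendre, harg]
  set θ := Complex.arg (horiz u.1)
  set r := Real.sqrt (1 - u.1 2 ^ 2)
  obtain ⟨k, rfl | rfl⟩ := m.eq_nat_or_neg
  · have h1 : ((l : ℤ) - k).toNat = l - k := by omega
    have h2 : ((l : ℤ) + k).toNat = l + k := by omega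
    rw [if_pos (by positivity), if_pos (by positivity), Int.natAbs_natCast, h1, h2,
      assocLegendreNat, ← hpol,
      show Complex.I * ((k : ℤ) : ℂ) * (θ : ℂ) = (k : ℕ) * ((θ : ℂ) * Complex.I) by
        push_cast; ring, Complex.exp_nat_mul, harmNorm]
    push_cast
    rw [neg_pow ((r : ℂ) * _), mul_pow]
    ring
  · rcases Nat.eq_zero_or_pos k with rfl | hk
    · simp [assocLegendreNat, harmNorm]
    have h0 : ¬ (0 : ℤ) ≤ -(k : ℤ) := by omega
    have h1 : ((l : ℤ) - -k).toNat = l + k := by omega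
    have h2 : ((l : ℤ) + -k).toNat = l - k := by omega
    have hconj : conj (horiz u.1) = (r : ℂ) * Complex.exp (-((θ : ℂ) * Complex.I)) := by
      rw [← hpol, map_mul, Complex.conj_ofReal, ← Complex.exp_conj]
      simp
    -- The factorial ratio in `P_l^{-k}`, moved under the root, inverts the one already there, so
    -- orders `k` and `-k` share a normalization.
    have hnorm : Real.sqrt ((2 * l + 1) / (4 * Real.pi) * (((l + k)! : ℝ) / ((l - k)! : ℝ)))
        * (((l - k)! : ℝ) / ((l + k)! : ℝ)) = harmNorm l k := by
      have hp := Real.pi_pos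
      rw [harmNorm, eq_comm, Real.sqrt_eq_iff_eq_sq (by positivity) (by positivity), mul_pow,
        Real.sq_sqrt (by positivity)]
      field_simp
    rw [if_neg h0, if_neg h0, Int.natAbs_neg, Int.natAbs_natCast, h1, h2,
      assocLegendreNat, hconj,
      show Complex.I * ((-(k : ℤ) : ℤ) : ℂ) * (θ : ℂ) = (k : ℕ) * (-((θ : ℂ) * Complex.I)) by
        push_cast; ring, Complex.exp_nat_mul, ← hnorm]
    push_cast
    have hsign : ((-1 : ℂ) ^ k) * (-1) ^ k = 1 := by rw [← mul_pow]; simp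
    rw [mul_pow]
    linear_combination (Real.sqrt ((2 * l + 1) / (4 * Real.pi)
      * (((l + k)! : ℝ) / ((l - k)! : ℝ))) : ℂ) * (((l - k)! : ℂ) / ((l + k)! : ℂ))
      * (r : ℂ) ^ k * (((Polynomial.derivative^[k] (legendre l)).eval (u.1 2) : ℝ) : ℂ)
      * Complex.exp (-((θ : ℂ) * Complex.I)) ^ k * hsign

@[fun_prop]
lemma continuous_horiz : Continuous horiz := by
  unfold horiz
  fun_prop

@[fun_prop]
lemma continuous_azimuthal (m : ℤ) : Continuous (azimuthal m) := by
  unfold azimuthal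
  split_ifs <;> fun_prop

@[fun_prop]
lemma continuous_harmPoly (l : ℕ) (m : ℤ) : Continuous (harmPoly l m) := by
  unfold harmPoly
  fun_prop

/-! ### Orthonormality -/

/-- The rotation by `θ` about the vertical axis. -/
def rotation (θ : ℝ) : E3 ≃ₗᵢ[ℝ] E3 :=
  LinearIsometry.toLinearIsometryEquiv
    { toFun := fun x => !₂[Real.cos θ * x 0 - Real.sin θ * x 1,
        Real.sin θ * x 0 + Real.cos θ * x 1, x 2]
      map_add' := fun x y => by
        ext i
        fin_cases i <;> simp <;> ring
      map_smul' := fun c x => by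
        ext i
        fin_cases i <;> simp <;> ring
      norm_map' := fun x => by
        rw [EuclideanSpace.norm_eq, EuclideanSpace.norm_eq, Fin.sum_univ_three,
          Fin.sum_univ_three]
        congr 1
        simp
        linear_combination (x 0 ^ 2 + x 1 ^ 2) * Real.sin_sq_add_cos_sq θ } rfl

lemma rotation_apply (θ : ℝ) (x : E3) :
    rotation θ x = !₂[Real.cos θ * x 0 - Real.sin θ * x 1,
      Real.sin θ * x 0 + Real.cos θ * x 1, x 2] := rfl

lemma horiz_rotation (θ : ℝ) (x : E3) :
    horiz (rotation θ x) = Complex.exp (θ * Complex.I) * horiz x := by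
  simp only [horiz, rotation_apply, Complex.exp_mul_I, ← Complex.ofReal_cos,
    ← Complex.ofReal_sin]
  simp
  linear_combination (-Complex.sin θ * x 1) * Complex.I_mul_I

lemma azimuthal_rotation (m : ℤ) (θ : ℝ) (x : E3) :
    azimuthal m (rotation θ x) = Complex.exp (m * (θ * Complex.I)) * azimuthal m x := by
  obtain ⟨k, rfl | rfl⟩ := m.eq_nat_or_neg
  · simp only [azimuthal, Int.natAbs_natCast, horiz_rotation, Nat.cast_nonneg, if_true]
    rw [Int.cast_natCast, Complex.exp_nat_mul, ← mul_pow]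
    ring
  · rcases Nat.eq_zero_or_pos k with rfl | hk
    · simp [azimuthal]
    have h0 : ¬ (0 : ℤ) ≤ -(k : ℤ) := by omega
    simp only [azimuthal, if_neg h0, Int.natAbs_neg, Int.natAbs_natCast, horiz_rotation, map_mul,
      ← Complex.exp_conj, Complex.conj_ofReal, Complex.conj_I]
    rw [show (((-(k : ℤ) : ℤ) : ℂ)) * (θ * Complex.I) = (k : ℕ) * (θ * -Complex.I) by
      push_cast; ring, Complex.exp_nat_mul, ← mul_pow]

lemma azimuthal_mul_conj (m : ℤ) (u : S2) :
    azimuthal m u.1 * conj (azimuthal m u.1)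
      = (((1 - u.1 2 ^ 2) ^ m.natAbs : ℝ) : ℂ) := by
  rw [Complex.ofReal_pow, ← horiz_mul_conj]
  unfold azimuthal
  split_ifs
  · rw [map_pow, ← mul_pow]
    simp
  · rw [map_pow, ← mul_pow, mul_comm]
    simp

lemma integral_harmPoly_mul_conj_of_ne {m m' : ℤ} (h : m ≠ m') (l l' : ℕ) :
    ∫ u : S2, harmPoly l m u.1 * conj (harmPoly l' m' u.1) ∂surf = 0 := by
  have hd : ((m - m' : ℤ) : ℝ) ≠ 0 := by exact_mod_cast sub_ne_zero.2 h
  -- Chosen so that the rotation multiplies the integrand by `e^{i(m-m')θ} = -1`.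
  set θ : ℝ := Real.pi / ((m - m' : ℤ) : ℝ) with hθ
  have hrot := integral_surf_comp_linearIsometryEquiv (rotation θ)
    (fun x => harmPoly l m x * conj (harmPoly l' m' x))
  have hphase : Complex.exp (m * (θ * Complex.I)) * conj (Complex.exp (m' * (θ * Complex.I)))
      = -1 := by
    rw [← Complex.exp_conj, ← Complex.exp_add, ← Complex.exp_pi_mul_I]
    congr 1
    have : ((m - m' : ℤ) : ℝ) * θ = Real.pi := by rw [hθ]; field_simp
    have := congrArg (Complex.ofReal) this
    push_cast at this
    simp only [map_mul, Complex.conj_ofReal, Complex.conj_I, map_intCast]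
    linear_combination Complex.I * this
  have hneg (u : S2) : harmPoly l m (rotation θ u.1) * conj (harmPoly l' m' (rotation θ u.1))
      = -(harmPoly l m u.1 * conj (harmPoly l' m' u.1)) := by
    have h2 : rotation θ u.1 2 = u.1 2 := by simp [rotation_apply]
    simp only [harmPoly, azimuthal_rotation, h2, map_mul]
    linear_combination ((harmNorm l m.natAbs : ℂ)
      * (((Polynomial.derivative^[m.natAbs] (legendre l)).eval (u.1 2) : ℝ) : ℂ)
      * azimuthal m u.1 * conj (harmNorm l' m'.natAbs : ℂ)
      * conj (((Polynomial.derivative^[m'.natAbs] (legendre l')).eval (u.1 2) : ℝ) : ℂ)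
      * conj (azimuthal m' u.1)) * hphase
  simp only [hneg, integral_neg] at hrot
  exact self_eq_neg.1 hrot.symm

/-- The azimuthal factors multiply to `(1 - x₃²)^|m|`, leaving a polynomial in the height, to which
Archimedes' formula applies. -/
lemma integral_harmPoly_mul_conj_same_order (m : ℤ) (l l' : ℕ) :
    ∫ u : S2, harmPoly l m u.1 * conj (harmPoly l' m u.1) ∂surf
      = ((harmNorm l m.natAbs * harmNorm l' m.natAbs
          * (2 * Real.pi * legendrePairing m.natAbs l l') : ℝ) : ℂ) := by
  rw [legendrePairing, segmentIntegral, Complex.ofReal_mul, ← integral_surf_eval_height,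
    ← integral_const_mul]
  refine integral_congr_ae (.of_forall fun u => ?_)
  have h := azimuthal_mul_conj m u
  simp only [harmPoly, map_mul, Complex.conj_ofReal, Polynomial.eval_mul, Polynomial.eval_pow,
    Polynomial.eval_sub, Polynomial.eval_one, Polynomial.eval_X]
  push_cast at h ⊢
  linear_combination ((harmNorm l m.natAbs : ℂ) * (harmNorm l' m.natAbs : ℂ)
      * (((Polynomial.derivative^[m.natAbs] (legendre l)).eval (u.1 2) : ℝ) : ℂ)
      * (((Polynomial.derivative^[m.natAbs] (legendre l')).eval (u.1 2) : ℝ) : ℂ)) * h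

lemma integral_harmPoly_mul_conj {l l' : ℕ} {m m' : ℤ} (hm : m ∈ Finset.Icc (-(l : ℤ)) l) :
    ∫ u : S2, harmPoly l m u.1 * conj (harmPoly l' m' u.1) ∂surf
      = if l = l' ∧ m = m' then 1 else 0 := by
  by_cases hmm : m = m'
  · subst hmm
    rw [integral_harmPoly_mul_conj_same_order]
    by_cases hl : l = l'
    · subst hl
      have hk : m.natAbs ≤ l := by
        rw [Finset.mem_Icc] at hm
        omega
      have hp := Real.pi_pos
      rw [legendrePairing_self hk, harmNorm, Real.mul_self_sqrt (by positivity), if_pos (by simp),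
        ← Complex.ofReal_one]
      congr 1
      field_simp
      norm_num
    · simp [legendrePairing_eq_zero hl, hl]
  · simp [integral_harmPoly_mul_conj_of_ne hmm, hmm]

/-! ### Polynomial functions and designs -/

/-- `f` is the restriction to the sphere of a complex polynomial of total degree at most `d`. -/
def IsPolyDegLE (d : ℕ) (f : S2 → ℂ) : Prop :=
  ∃ q r : MvPolynomial (Fin 3) ℝ, q.totalDegree ≤ d ∧ r.totalDegree ≤ d ∧
    ∀ u : S2, f u = (MvPolynomial.eval (fun c => u.1 c) q : ℝ) +
      (MvPolynomial.eval (fun c => u.1 c) r : ℝ) * Complex.I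

namespace IsPolyDegLE

lemma const (c : ℂ) : IsPolyDegLE 0 fun _ => c :=
  ⟨.C c.re, .C c.im, by simp, by simp, fun u => by simp⟩

lemma coord (i : Fin 3) : IsPolyDegLE 1 fun u => (u.1 i : ℂ) :=
  ⟨.X i, 0, by simp, by simp, fun u => by simp⟩

variable {d e : ℕ} {f g : S2 → ℂ}

lemma mono (hf : IsPolyDegLE d f) (h : d ≤ e) : IsPolyDegLE e f := by
  obtain ⟨q, r, hq, hr, H⟩ := hf
  exact ⟨q, r, hq.trans h, hr.trans h, H⟩

lemma conjugate (hf : IsPolyDegLE d f) : IsPolyDegLE d fun u => conj (f u) := by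
  obtain ⟨q, r, hq, hr, H⟩ := hf
  exact ⟨q, -r, hq, by rwa [MvPolynomial.totalDegree_neg], fun u => by simp [H]⟩

lemma add (hf : IsPolyDegLE d f) (hg : IsPolyDegLE d g) : IsPolyDegLE d fun u => f u + g u := by
  obtain ⟨q, r, hq, hr, H⟩ := hf
  obtain ⟨q', r', hq', hr', H'⟩ := hg
  refine ⟨q + q', r + r', (MvPolynomial.totalDegree_add _ _).trans (max_le hq hq'),
    (MvPolynomial.totalDegree_add _ _).trans (max_le hr hr'), fun u => ?_⟩
  simp [H, H']
  ring

lemma mul (hf : IsPolyDegLE d f) (hg : IsPolyDegLE e g) :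
    IsPolyDegLE (d + e) fun u => f u * g u := by
  obtain ⟨q, r, hq, hr, H⟩ := hf
  obtain ⟨q', r', hq', hr', H'⟩ := hg
  have hmul {a b : MvPolynomial (Fin 3) ℝ} (ha : a.totalDegree ≤ d) (hb : b.totalDegree ≤ e) :
      (a * b).totalDegree ≤ d + e :=
    (MvPolynomial.totalDegree_mul _ _).trans (add_le_add ha hb)
  refine ⟨q * q' - r * r', q * r' + r * q',
    (MvPolynomial.totalDegree_sub _ _).trans (max_le (hmul hq hq') (hmul hr hr')),
    (MvPolynomial.totalDegree_add _ _).trans (max_le (hmul hq hr') (hmul hr hq')), fun u => ?_⟩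
  simp [H, H']
  linear_combination ((MvPolynomial.eval (fun c => u.1 c) r : ℝ) : ℂ) *
    (MvPolynomial.eval (fun c => u.1 c) r' : ℝ) * Complex.I_mul_I

lemma pow (hf : IsPolyDegLE d f) (k : ℕ) : IsPolyDegLE (d * k) fun u => f u ^ k := by
  induction k with
  | zero => simpa using const 1
  | succ k ih => simpa [pow_succ, mul_add] using ih.mul hf

lemma sum {ι : Type*} (s : Finset ι) {F : ι → S2 → ℂ} (h : ∀ i ∈ s, IsPolyDegLE d (F i)) :
    IsPolyDegLE d fun u => ∑ i ∈ s, F i u := by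
  classical
  induction s using Finset.induction_on with
  | empty => simpa using (const 0).mono (Nat.zero_le d)
  | insert i s hi ih =>
    simp only [Finset.sum_insert hi]
    exact (h i (by simp)).add (ih fun j hj => h j (by simp [hj]))

lemma eval_height (p : Polynomial ℝ) :
    IsPolyDegLE p.natDegree fun u => ((p.eval (u.1 2) : ℝ) : ℂ) := by
  simp only [Polynomial.eval_eq_sum_range, Complex.ofReal_sum, Complex.ofReal_mul,
    Complex.ofReal_pow]
  refine sum _ fun i hi => ((const _).mul ((coord 2).pow i)).mono ?_
  rw [Finset.mem_range] at hi
  omega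

lemma harmPoly {l : ℕ} {m : ℤ} (hm : m ∈ Finset.Icc (-(l : ℤ)) l) :
    IsPolyDegLE l fun u => harmPoly l m u.1 := by
  have hk : m.natAbs ≤ l := by
    rw [Finset.mem_Icc] at hm
    omega
  have hh : IsPolyDegLE 1 fun u => horiz u.1 := by
    simpa [horiz] using (coord 0).add ((coord 1).mul (const Complex.I))
  have ha : IsPolyDegLE m.natAbs fun u => azimuthal m u.1 := by
    unfold azimuthal
    split_ifs
    · simpa using ((const (-1)).mul hh).pow m.natAbs
    · simpa using hh.conjugate.pow m.natAbs
  -- Degree at most `l - |m|` from the height and `|m|` from the azimuthal factor.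
  refine (((const (harmNorm l m.natAbs)).mul (eval_height _)).mul ha).mono ?_
  have := natDegree_iterate_derivative_legendre_le l m.natAbs
  omega

end IsPolyDegLE

lemma IsSphericalDesign.sum_eq_integral {t N : ℕ} {x : Fin N → S2} (hx : IsSphericalDesign t x)
    {f : S2 → ℂ} (hf : IsPolyDegLE t f) :
    ((4 * Real.pi / N : ℝ) : ℂ) * ∑ i, f (x i) = ∫ u, f u ∂surf := by
  obtain ⟨q, r, hq, hr, H⟩ := hf
  have hcont (p : MvPolynomial (Fin 3) ℝ) :
      Continuous fun u : S2 => MvPolynomial.eval (fun c => u.1 c) p :=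
    p.continuous_eval.comp (by fun_prop)
  have hint (p : MvPolynomial (Fin 3) ℝ) :
      Integrable (fun u : S2 => ((MvPolynomial.eval (fun c => u.1 c) p : ℝ) : ℂ)) surf :=
    integrable_surf_of_continuous (Complex.continuous_ofReal.comp (hcont p))
  have hreal {p : MvPolynomial (Fin 3) ℝ} (hp : p.totalDegree ≤ t) :
      4 * Real.pi / N * ∑ i, MvPolynomial.eval (fun c => (x i).1 c) p
        = ∫ y, MvPolynomial.eval (fun c => y.1 c) p ∂surf := by
    have h := hx p hp
    have hpi := Real.pi_pos.ne'
    rw [surf_real_univ] at h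
    rw [div_eq_mul_one_div, mul_assoc, h]
    field_simp
  simp only [H]
  rw [integral_add (hint q) ((hint r).mul_const _), integral_mul_const, integral_complex_ofReal,
    integral_complex_ofReal, ← hreal hq, ← hreal hr, Finset.sum_add_distrib, ← Finset.sum_mul]
  push_cast
  ring

/-! ### Completeness -/

/-- The index set of the spherical harmonics. -/
abbrev HarmIndex : Type := Σ l : ℕ, Finset.Icc (-(l : ℤ)) (l : ℤ)

/-- The spherical harmonics as continuous functions. -/
def harmC (i : HarmIndex) : C(S2, ℂ) := ⟨fun u => harmPoly i.1 i.2 u.1, by fun_prop⟩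

/-- The function `g(x₃)` times the azimuthal factor of order `m`. -/
def heightMulAzimuthal (g : Polynomial ℝ) (m : ℤ) : C(S2, ℂ) :=
  ⟨fun u => ((g.eval (u.1 2) : ℝ) : ℂ) * azimuthal m u.1,
    (Complex.continuous_ofReal.comp (g.continuous.comp (by fun_prop))).mul (by fun_prop)⟩

lemma heightMulAzimuthal_apply (g : Polynomial ℝ) (m : ℤ) (u : S2) :
    heightMulAzimuthal g m u = ((g.eval (u.1 2) : ℝ) : ℂ) * azimuthal m u.1 := rfl

/-- The linear span of the spherical harmonics. -/
def harmSpan : Submodule ℂ C(S2, ℂ) := Submodule.span ℂ (Set.range harmC)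

/-- Triangular elimination: the `|m|`-th derivatives of the `P_{|m|+d}` have degree exactly `d`, so
subtracting a multiple of one lowers the degree of `g`. -/
lemma heightMulAzimuthal_mem (m : ℤ) (d : ℕ) :
    ∀ g : Polynomial ℝ, g.natDegree < d → heightMulAzimuthal g m ∈ harmSpan := by
  induction d with
  | zero => intro g hg; omega
  | succ d ih =>
    intro g hg
    set k := m.natAbs
    set p := Polynomial.derivative^[k] (legendre (k + d)) with hp
    have hpd : p.natDegree = d := by
      rw [hp, natDegree_iterate_derivative_legendre (by omega)]
      omega
    have hpc : p.coeff d ≠ 0 := by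
      have := coeff_iterate_derivative_legendre (show k ≤ k + d by omega)
      rw [Nat.add_sub_cancel_left] at this
      rw [this]
      have : (2 * (k + d)).descFactorial (k + d + k) ≠ 0 := by
        rw [Ne, Nat.descFactorial_eq_zero_iff_lt]
        omega
      positivity
    have hpm : heightMulAzimuthal p m ∈ harmSpan := by
      have hm : m ∈ Finset.Icc (-((k + d : ℕ) : ℤ)) ((k + d : ℕ) : ℤ) := by
        rw [Finset.mem_Icc]
        omega
      have hn : (harmNorm (k + d) k : ℂ) ≠ 0 := by
        have := Real.pi_pos
        rw [Complex.ofReal_ne_zero]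
        unfold harmNorm
        positivity
      have h : heightMulAzimuthal p m = (harmNorm (k + d) k : ℂ)⁻¹ • harmC ⟨k + d, m, hm⟩ := by
        ext u
        simp only [heightMulAzimuthal_apply, harmC, ContinuousMap.smul_apply, ContinuousMap.coe_mk,
          harmPoly, smul_eq_mul]
        change _ = _ * ((harmNorm (k + d) k : ℂ) * ((p.eval (u.1 2) : ℝ) : ℂ) * _)
        field_simp
      rw [h]
      exact harmSpan.smul_mem _ (Submodule.subset_span ⟨_, rfl⟩)
    set c := g.coeff d / p.coeff d
    have hsplit : heightMulAzimuthal g m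
        = (c : ℂ) • heightMulAzimuthal p m + heightMulAzimuthal (g - Polynomial.C c * p) m := by
      ext u
      simp only [heightMulAzimuthal_apply, ContinuousMap.smul_apply, ContinuousMap.add_apply,
        smul_eq_mul, Polynomial.eval_sub, Polynomial.eval_mul, Polynomial.eval_C]
      push_cast
      ring
    have hcoeff : (g - Polynomial.C c * p).coeff d = 0 := by
      simp only [Polynomial.coeff_sub, Polynomial.coeff_C_mul, c]
      field_simp
      ring
    have hdeg : (g - Polynomial.C c * p).natDegree ≤ d :=
      (Polynomial.natDegree_sub_le _ _).trans (max_le (by omega)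
        ((Polynomial.natDegree_C_mul_le _ _).trans hpd.le))
    rw [hsplit]
    refine harmSpan.add_mem (harmSpan.smul_mem _ hpm) ?_
    -- For `d = 0` the `natDegree` cannot drop further, but the remainder is zero.
    rcases Nat.eq_zero_or_pos d with rfl | hd
    · have : g - Polynomial.C c * p = 0 := by
        rw [Polynomial.eq_C_of_natDegree_le_zero hdeg, hcoeff, map_zero]
      rw [this]
      convert harmSpan.zero_mem
      ext u
      simp [heightMulAzimuthal_apply]
    · refine ih _ (lt_of_le_of_ne hdeg fun h => ?_)
      have h0 : (g - Polynomial.C c * p) = 0 := by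
        rw [← Polynomial.leadingCoeff_eq_zero, Polynomial.leadingCoeff, h, hcoeff]
      rw [h0] at h
      simp at h
      omega

/-- The functions `x₃` and `x₁ + i x₂` on the sphere. -/
def coordC (b : Bool) : C(S2, ℂ) :=
  ⟨fun u => if b then (u.1 2 : ℂ) else horiz u.1, by cases b <;> simp <;> fun_prop⟩

/-- The order goes up by one. For `m < 0` one conjugate factor is consumed through `|x₁ + i x₂|² = 1
- x₃²`. -/
lemma horiz_mul_azimuthal (m : ℤ) : ∃ q : Polynomial ℝ, ∀ u : S2,
    horiz u.1 * azimuthal m u.1 = ((q.eval (u.1 2) : ℝ) : ℂ) * azimuthal (m + 1) u.1 := by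
  by_cases hm : 0 ≤ m
  · refine ⟨-1, fun u => ?_⟩
    obtain ⟨k, rfl⟩ := Int.eq_ofNat_of_zero_le hm
    have h1 : ((k : ℤ) + 1).natAbs = k + 1 := by omega
    simp only [azimuthal, if_pos hm, if_pos (show (0 : ℤ) ≤ (k : ℤ) + 1 by omega), h1]
    simp [pow_succ]
    ring
  · refine ⟨1 - Polynomial.X ^ 2, fun u => ?_⟩
    obtain ⟨k, hk⟩ : ∃ k : ℕ, m = -(k + 1 : ℕ) := ⟨(m + 1).natAbs, by omega⟩
    have h := horiz_mul_conj u
    have h1 : m.natAbs = k + 1 := by omega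
    have h2 : (m + 1).natAbs = k := by omega
    have h3 : azimuthal (m + 1) u.1 = conj (horiz u.1) ^ k := by
      rw [azimuthal, h2]
      split_ifs with h0
      · have : k = 0 := by omega
        simp [this]
      · rfl
    rw [h3, azimuthal, if_neg hm, h1]
    simp only [Polynomial.eval_sub, Polynomial.eval_one, Polynomial.eval_pow, Polynomial.eval_X]
    rw [← h]
    ring

lemma conj_horiz_mul_azimuthal (m : ℤ) : ∃ q : Polynomial ℝ, ∀ u : S2,
    conj (horiz u.1) * azimuthal m u.1
      = ((q.eval (u.1 2) : ℝ) : ℂ) * azimuthal (m - 1) u.1 := by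
  by_cases hm : m ≤ 0
  · refine ⟨1, fun u => ?_⟩
    obtain ⟨k, hk⟩ : ∃ k : ℕ, m = -(k : ℤ) := ⟨m.natAbs, by omega⟩
    have h1 : m.natAbs = k := by omega
    have h2 : (m - 1).natAbs = k + 1 := by omega
    have h3 : azimuthal m u.1 = conj (horiz u.1) ^ k := by
      rw [azimuthal, h1]
      split_ifs with h0
      · have : k = 0 := by omega
        simp [this]
      · rfl
    rw [h3, azimuthal, if_neg (by omega), h2]
    simp [pow_succ]
    ring
  · refine ⟨Polynomial.X ^ 2 - 1, fun u => ?_⟩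
    obtain ⟨k, hk⟩ : ∃ k : ℕ, m = (k + 1 : ℕ) := ⟨(m - 1).natAbs, by omega⟩
    have h := horiz_mul_conj u
    have h1 : m.natAbs = k + 1 := by omega
    have h2 : (m - 1).natAbs = k := by omega
    rw [azimuthal, azimuthal, if_pos (by omega), if_pos (by omega), h1, h2]
    simp only [Polynomial.eval_sub, Polynomial.eval_one, Polynomial.eval_pow, Polynomial.eval_X]
    push_cast at h ⊢
    linear_combination (-(-horiz u.1) ^ k) * h

lemma mul_mem_harmSpan_of_azimuthal {f : C(S2, ℂ)} {e : ℤ}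
    (hf : ∀ m : ℤ, ∃ q : Polynomial ℝ, ∀ u : S2,
      f u * azimuthal m u.1 = ((q.eval (u.1 2) : ℝ) : ℂ) * azimuthal (m + e) u.1)
    {v : C(S2, ℂ)} (hv : v ∈ harmSpan) : f * v ∈ harmSpan := by
  induction hv using Submodule.span_induction with
  | mem v hv =>
    obtain ⟨⟨l, m⟩, rfl⟩ := hv
    obtain ⟨q, hq⟩ := hf m
    have h : f * harmC ⟨l, m⟩ = (harmNorm l (m : ℤ).natAbs : ℂ) • heightMulAzimuthal
        (Polynomial.derivative^[(m : ℤ).natAbs] (legendre l) * q) (m + e) := by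
      ext u
      simp only [ContinuousMap.mul_apply, ContinuousMap.smul_apply, heightMulAzimuthal_apply,
        harmC, ContinuousMap.coe_mk, harmPoly, Polynomial.eval_mul, smul_eq_mul]
      push_cast
      linear_combination (harmNorm l (m : ℤ).natAbs : ℂ) * (((Polynomial.derivative^[
        (m : ℤ).natAbs] (legendre l)).eval (u.1 2) : ℝ) : ℂ) * hq u
    rw [h]
    exact harmSpan.smul_mem _ (heightMulAzimuthal_mem _ _ _ (Nat.lt_succ_self _))
  | zero => simp
  | add x y _ _ hx hy =>
    rw [mul_add]
    exact harmSpan.add_mem hx hy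
  | smul c x _ hx =>
    rw [mul_smul_comm]
    exact harmSpan.smul_mem _ hx

lemma adjoin_le_harmSpan {f : C(S2, ℂ)} (hf : f ∈ StarAlgebra.adjoin ℂ (Set.range coordC)) :
    f ∈ harmSpan := by
  -- Stability of the span under multiplication by `f` passes to sums and products of such `f`,
  -- unlike bare membership; applied to `v = 1` it gives the claim.
  suffices h : ∀ v ∈ harmSpan, f * v ∈ harmSpan by
    have h1 : (1 : C(S2, ℂ)) ∈ harmSpan := by
      have := heightMulAzimuthal_mem 0 1 1 (by simp)
      convert this
      ext u
      simp [heightMulAzimuthal_apply, azimuthal]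
    simpa using h 1 h1
  have hz (m : ℤ) : ∃ q : Polynomial ℝ, ∀ u : S2,
      (u.1 2 : ℂ) * azimuthal m u.1 = ((q.eval (u.1 2) : ℝ) : ℂ) * azimuthal (m + 0) u.1 :=
    ⟨Polynomial.X, fun u => by simp⟩
  have hf' : f ∈ Algebra.adjoin ℂ (Set.range coordC ∪ star (Set.range coordC)) := by
    rw [← StarAlgebra.adjoin_toSubalgebra]
    exact hf
  clear hf
  induction hf' using Algebra.adjoin_induction with
  | mem x hx =>
    intro v hv
    rcases hx with ⟨b, rfl⟩ | ⟨b, hb⟩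
    · cases b
      · exact mul_mem_harmSpan_of_azimuthal (e := 1)
          (fun m => by simpa [coordC] using horiz_mul_azimuthal m) hv
      · exact mul_mem_harmSpan_of_azimuthal (e := 0) (fun m => by simpa [coordC] using hz m) hv
    · obtain rfl : x = star (coordC b) := by rw [hb, star_star]
      cases b
      · exact mul_mem_harmSpan_of_azimuthal (e := -1)
          (fun m => by simpa [coordC, sub_eq_add_neg] using conj_horiz_mul_azimuthal m) hv
      · exact mul_mem_harmSpan_of_azimuthal (e := 0) (fun m => by simpa [coordC] using hz m) hv
  | algebraMap r =>
    intro v hv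
    rw [← Algebra.smul_def]
    exact harmSpan.smul_mem _ hv
  | add x y _ _ ihx ihy =>
    intro v hv
    rw [add_mul]
    exact harmSpan.add_mem (ihx v hv) (ihy v hv)
  | mul x y _ _ ihx ihy =>
    intro v hv
    rw [mul_assoc]
    exact ihx _ (ihy v hv)

/-- Stone–Weierstrass: `x₃` and `x₁ + i x₂` separate points, and the star algebra they generate lies
in the span. -/
lemma harmSpan_dense : harmSpan.topologicalClosure = ⊤ := by
  have hsep : (StarAlgebra.adjoin ℂ (Set.range coordC)).SeparatesPoints := by
    intro u v huv
    by_contra hne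
    have h (b : Bool) : coordC b u = coordC b v := by
      by_contra hb
      exact hne ⟨_, ⟨_, StarAlgebra.subset_adjoin ℂ _ ⟨b, rfl⟩, rfl⟩, hb⟩
    have h2 := h true
    have h01 := h false
    simp only [coordC, ContinuousMap.coe_mk, if_true, Complex.ofReal_inj] at h2
    simp only [coordC, ContinuousMap.coe_mk, horiz, Complex.ext_iff] at h01
    simp at h01
    refine huv (Subtype.ext ?_)
    ext i
    fin_cases i
    · exact h01.1
    · exact h01.2
    · exact h2
  have hd := ContinuousMap.starSubalgebra_topologicalClosure_eq_top_of_separatesPoints _ hsep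
  rw [eq_top_iff]
  intro f _
  have hf : f ∈ (StarAlgebra.adjoin ℂ (Set.range coordC)).topologicalClosure := by
    rw [hd]
    trivial
  exact closure_mono (fun g hg => adjoin_le_harmSpan hg) hf

/-- The space `L²(𝕊²)`. -/
abbrev L2S : Type := Lp ℂ 2 surf

/-- The spherical harmonics as elements of `L²(𝕊²)`. -/
def harmL2 (i : HarmIndex) : L2S := ContinuousMap.toLp 2 surf ℂ (harmC i)

lemma orthonormal_harmL2 : Orthonormal ℂ harmL2 := by
  classical
  rw [orthonormal_iff_ite]
  rintro ⟨l, m⟩ ⟨l', m'⟩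
  rw [harmL2, harmL2, ContinuousMap.inner_toLp]
  refine (integral_harmPoly_mul_conj m'.2).trans ?_
  congr 1
  apply propext
  constructor
  · rintro ⟨rfl, h⟩
    rw [Subtype.ext h]
  · intro h
    cases h
    exact ⟨rfl, rfl⟩

lemma harmL2_span_dense : ⊤ ≤ (Submodule.span ℂ (Set.range harmL2)).topologicalClosure := by
  have h := (ContinuousMap.toLp_denseRange ℂ surf ℂ
    (ENNReal.ofNat_ne_top : (2 : ENNReal) ≠ ⊤)).topologicalClosure_map_submodule harmSpan_dense
  rw [← h, harmSpan, Submodule.map_span, ← Set.range_comp]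
  exact le_rfl

/-- The Hilbert basis of spherical harmonics. -/
def harmBasis : HilbertBasis HarmIndex ℂ L2S :=
  HilbertBasis.mk orthonormal_harmL2 harmL2_span_dense

lemma coe_harmBasis : ⇑harmBasis = harmL2 := HilbertBasis.coe_mk _ _

/-! ### Framelets -/

/-- The indices of the spherical harmonics of degree less than `L`. -/
def indexBelow (L : ℕ) : Finset HarmIndex := (Finset.range L).sigma fun _ => Finset.univ

lemma mem_indexBelow {L : ℕ} {i : HarmIndex} : i ∈ indexBelow L ↔ i.1 < L := by
  simp [indexBelow]

lemma harmC_apply (i : HarmIndex) (u : S2) : harmC i u = sphHarm i.1 i.2 u :=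
  (sphHarm_eq_harmPoly i.2.2 u).symm

lemma framelet_eq_sum {g : ℝ → ℂ} {t L : ℕ} (hL : ∀ l : ℕ, 𝓕 g ((l : ℝ) / t) ≠ 0 → l < L)
    (Q : QuadRule) (k : Fin Q.N) (u : S2) :
    framelet g t Q k u = (Real.sqrt (Q.wt k) : ℂ) *
      ∑ i ∈ indexBelow L, 𝓕 g ((i.1 : ℝ) / t) * conj (harmC i (Q.pts k)) * harmC i u := by
  rw [framelet, indexBelow, Finset.sum_sigma, tsum_eq_sum (s := Finset.range L)]
  · congr 1
    refine Finset.sum_congr rfl fun l _ => ?_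
    simp only [harmC_apply]
    exact (Finset.sum_coe_sort (Finset.Icc (-(l : ℤ)) l) fun m =>
      𝓕 g ((l : ℝ) / t) * conj (sphHarm l m (Q.pts k)) * sphHarm l m u).symm
  · intro l hl
    have h0 : 𝓕 g ((l : ℝ) / t) = 0 := by
      by_contra h
      exact hl (Finset.mem_range.2 (hL l h))
    simp [h0]

lemma memLp_continuousMap (g : C(S2, ℂ)) : MemLp g 2 surf := by
  have h := Lp.memLp (ContinuousMap.toLp 2 surf ℂ g)
  exact h.ae_eq (ContinuousMap.coeFn_toLp surf g)

lemma integrable_mul_conj {f : S2 → ℂ} (hf : MemLp f 2 surf) (g : C(S2, ℂ)) :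
    Integrable (fun u => f u * conj (g u)) surf :=
  hf.integrable_mul (memLp_continuousMap (star g))

lemma ip_framelet {f : S2 → ℂ} (hf : MemLp f 2 surf) {g : ℝ → ℂ} {t L : ℕ}
    (hL : ∀ l : ℕ, 𝓕 g ((l : ℝ) / t) ≠ 0 → l < L) (Q : QuadRule) (k : Fin Q.N) :
    ip f (framelet g t Q k) = (Real.sqrt (Q.wt k) : ℂ) *
      ∑ i ∈ indexBelow L, conj (𝓕 g ((i.1 : ℝ) / t)) * harmC i (Q.pts k) * ip f (harmC i) := by
  have h (u : S2) : f u * conj (framelet g t Q k u) = (Real.sqrt (Q.wt k) : ℂ) *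
      ∑ i ∈ indexBelow L, conj (𝓕 g ((i.1 : ℝ) / t)) * harmC i (Q.pts k) *
        (f u * conj (harmC i u)) := by
    rw [framelet_eq_sum hL, map_mul, Complex.conj_ofReal, map_sum, mul_left_comm, Finset.mul_sum]
    congr 1
    refine Finset.sum_congr rfl fun i _ => ?_
    simp only [map_mul, Complex.conj_conj]
    ring
  simp only [ip, h]
  rw [integral_const_mul, integral_finsetSum _ fun i _ => (integrable_mul_conj hf _).const_mul _]
  simp only [integral_const_mul]

lemma integral_harmC_mul_conj (i i' : HarmIndex) :
    ∫ u, harmC i u * conj (harmC i' u) ∂surf = if i' = i then 1 else 0 := by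
  have h := orthonormal_iff_ite.1 orthonormal_harmL2 i' i
  rw [harmL2, harmL2, ContinuousMap.inner_toLp] at h
  exact h

/-- Expanding both framelets gives a double sum over harmonics weighted by quadratures of `Y_i conj
Y_i'`. Where both coefficients are nonzero, `2l ≤ T` and `2l' ≤ T` give `l + l' ≤ T`, so the design
is exact and only the diagonal survives. -/
lemma sum_ip_framelet_mul {f : S2 → ℂ} (hf : MemLp f 2 surf) {g : ℝ → ℂ} {t L T N : ℕ}
    (hL : ∀ l : ℕ, 𝓕 g ((l : ℝ) / t) ≠ 0 → l < L)
    (hT : ∀ l : ℕ, 𝓕 g ((l : ℝ) / t) ≠ 0 → 2 * l ≤ T)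
    {x : Fin N → S2} (hx : IsSphericalDesign T x) (u : S2) :
    ∑ k, ip f (framelet g t (equalWeightRule x) k) * framelet g t (equalWeightRule x) k u
      = ∑ i ∈ indexBelow L, ((‖𝓕 g ((i.1 : ℝ) / t)‖ ^ 2 : ℝ) : ℂ) * ip f (harmC i)
          * harmC i u := by
  have hw : ((Real.sqrt (4 * Real.pi / N) : ℝ) : ℂ) * (Real.sqrt (4 * Real.pi / N) : ℝ)
      = ((4 * Real.pi / N : ℝ) : ℂ) := by
    rw [← Complex.ofReal_mul, Real.mul_self_sqrt]
    have := Real.pi_pos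
    positivity
  have hquad (i i' : HarmIndex) (h : 𝓕 g ((i.1 : ℝ) / t) ≠ 0) (h' : 𝓕 g ((i'.1 : ℝ) / t) ≠ 0) :
      ((4 * Real.pi / N : ℝ) : ℂ) * ∑ k, harmC i (x k) * conj (harmC i' (x k))
        = if i' = i then 1 else 0 := by
    rw [← integral_harmC_mul_conj, ← hx.sum_eq_integral (f := fun u => harmC i u *
      conj (harmC i' u))]
    refine ((IsPolyDegLE.harmPoly i.2.2).mul (IsPolyDegLE.harmPoly i'.2.2).conjugate).mono ?_
    have := hT _ h
    have := hT _ h'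
    omega
  calc ∑ k, ip f (framelet g t (equalWeightRule x) k) * framelet g t (equalWeightRule x) k u
      = ∑ k, ∑ i ∈ indexBelow L, ∑ i' ∈ indexBelow L,
          (conj (𝓕 g ((i.1 : ℝ) / t)) * ip f (harmC i) * 𝓕 g ((i'.1 : ℝ) / t) * harmC i' u) *
          (((4 * Real.pi / N : ℝ) : ℂ) * (harmC i (x k) * conj (harmC i' (x k)))) := by
        refine Finset.sum_congr rfl fun k _ => ?_
        rw [ip_framelet hf hL, framelet_eq_sum hL, ← hw]
        simp only [equalWeightRule]
        rw [mul_mul_mul_comm, Finset.sum_mul_sum, Finset.mul_sum]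
        refine Finset.sum_congr rfl fun i _ => ?_
        rw [Finset.mul_sum]
        refine Finset.sum_congr rfl fun i' _ => ?_
        ring
    _ = ∑ i ∈ indexBelow L, ∑ i' ∈ indexBelow L,
          (conj (𝓕 g ((i.1 : ℝ) / t)) * ip f (harmC i) * 𝓕 g ((i'.1 : ℝ) / t) * harmC i' u) *
          (((4 * Real.pi / N : ℝ) : ℂ) * ∑ k, harmC i (x k) * conj (harmC i' (x k))) := by
        rw [Finset.sum_comm]
        refine Finset.sum_congr rfl fun i _ => ?_
        rw [Finset.sum_comm]
        refine Finset.sum_congr rfl fun i' _ => ?_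
        rw [Finset.mul_sum, Finset.mul_sum]
    _ = ∑ i ∈ indexBelow L, ∑ i' ∈ indexBelow L,
          (conj (𝓕 g ((i.1 : ℝ) / t)) * ip f (harmC i) * 𝓕 g ((i'.1 : ℝ) / t) * harmC i' u) *
          (if i' = i then 1 else 0) := by
        refine Finset.sum_congr rfl fun i _ => Finset.sum_congr rfl fun i' _ => ?_
        by_cases h : 𝓕 g ((i.1 : ℝ) / t) = 0
        · simp [h]
        by_cases h' : 𝓕 g ((i'.1 : ℝ) / t) = 0
        · simp [h']
        rw [hquad i i' h h']
    _ = _ := by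
        refine Finset.sum_congr rfl fun i hi => ?_
        simp only [mul_ite, mul_one, mul_zero, Finset.sum_ite_eq', if_pos hi]
        have := Complex.mul_conj' (𝓕 g ((i.1 : ℝ) / t))
        push_cast
        rw [← this]
        ring

/-! ### Framelet expansions as multipliers -/

/-- The factor by which the `M`-th partial expansion at scale `J` multiplies the spherical
harmonics of degree `l`. -/
def expansionMultiplier {n : ℕ} (α : ℝ → ℂ) (β : Fin n → ℝ → ℂ) (t : ℤ → ℕ) (J : ℤ) (M l : ℕ) :
    ℝ :=
  ‖𝓕 α ((l : ℝ) / t J)‖ ^ 2 +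
    ∑ i ∈ Finset.range M, ∑ s, ‖𝓕 (β s) ((l : ℝ) / t (J + i))‖ ^ 2

section Expansion

variable {n : ℕ} {α : ℝ → ℂ} {β : Fin n → ℝ → ℂ} {t : ℤ → ℕ} {N : ℤ → ℕ}
  {x : (j : ℤ) → Fin (N j) → S2} {J : ℤ}

lemma expansionMultiplier_nonneg (M l : ℕ) : 0 ≤ expansionMultiplier α β t J M l := by
  unfold expansionMultiplier
  positivity

lemma expansionMultiplier_monotone (l : ℕ) :
    Monotone fun M => expansionMultiplier α β t J M l := by
  refine monotone_nat_of_le_succ fun M => ?_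
  simp only [expansionMultiplier, Finset.sum_range_succ]
  have : 0 ≤ ∑ s, ‖𝓕 (β s) ((l : ℝ) / t (J + M))‖ ^ 2 := by positivity
  linarith

lemma partialExpansion_eq_sum (hα : ∀ l : ℕ, 𝓕 α ((l : ℝ) / t J) ≠ 0 → 2 * l ≤ t J)
    (hβ : ∀ (s : Fin n) (j : ℤ), J ≤ j → ∀ l : ℕ, 𝓕 (β s) ((l : ℝ) / t j) ≠ 0 →
      2 * l ≤ t (j + 1))
    (hx : ∀ j, J ≤ j → IsSphericalDesign (t j) (x j))
    {f : S2 → ℂ} (hf : MemLp f 2 surf) (M : ℕ) :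
    ∃ L : ℕ, (∀ l, L ≤ l → expansionMultiplier α β t J M l = 0) ∧
      ∀ u, partialExpansion α β t (fun j => equalWeightRule (x j)) J f M u
        = ∑ i ∈ indexBelow L, (expansionMultiplier α β t J M i.1 : ℂ) * ip f (harmC i)
          * harmC i u := by
  -- A crude common bound: one cutoff exceeding every degree that occurs in any of the scales
  -- involved.
  set L := t J + ∑ i ∈ Finset.range M, t (J + i + 1) + 1 with hLdef
  have hLα (l : ℕ) (h : 𝓕 α ((l : ℝ) / t J) ≠ 0) : l < L := by
    have := hα l h
    omega
  have hLβ (s : Fin n) (i : ℕ) (hi : i ∈ Finset.range M) (l : ℕ)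
      (h : 𝓕 (β s) ((l : ℝ) / t (J + i)) ≠ 0) : l < L := by
    have h1 := hβ s (J + i) (by omega) l h
    have h2 := Finset.single_le_sum (f := fun i : ℕ => t (J + i + 1)) (fun _ _ => Nat.zero_le _) hi
    omega
  refine ⟨L, fun l hl => ?_, fun u => ?_⟩
  · have h1 : 𝓕 α ((l : ℝ) / t J) = 0 := by
      by_contra h
      exact absurd (hLα l h) (by omega)
    rw [expansionMultiplier, h1, Finset.sum_eq_zero]
    · simp
    · intro i hi
      refine Finset.sum_eq_zero fun s _ => ?_
      have h2 : 𝓕 (β s) ((l : ℝ) / t (J + i)) = 0 := by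
        by_contra h
        exact absurd (hLβ s i hi l h) (by omega)
      simp [h2]
  · have h1 := sum_ip_framelet_mul hf hLα hα (hx J le_rfl) u
    have h2 (s : Fin n) (i : ℕ) (hi : i ∈ Finset.range M) :=
      sum_ip_framelet_mul hf (hLβ s i hi) (hβ s (J + i) (by omega)) (hx (J + i + 1) (by omega)) u
    have h3 : ∑ i ∈ Finset.range M, ∑ k, ∑ s,
        ip f (psi β t (fun j => equalWeightRule (x j)) s (J + i) k) *
          psi β t (fun j => equalWeightRule (x j)) s (J + i) k u
        = ∑ i ∈ Finset.range M, ∑ s, ∑ h ∈ indexBelow L,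
          ((‖𝓕 (β s) ((h.1 : ℝ) / t (J + i))‖ ^ 2 : ℝ) : ℂ) * ip f (harmC h) * harmC h u := by
      refine Finset.sum_congr rfl fun i hi => ?_
      rw [Finset.sum_comm]
      exact Finset.sum_congr rfl fun s _ => h2 s i hi
    rw [partialExpansion, h3]
    refine (congrArg (· + _) h1).trans ?_
    simp only [expansionMultiplier, Complex.ofReal_add, Complex.ofReal_sum, add_mul,
      Finset.sum_mul, Finset.sum_add_distrib]
    congr 1
    rw [Finset.sum_comm (s := indexBelow L)]
    refine Finset.sum_congr rfl fun i _ => ?_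
    rw [Finset.sum_comm]

lemma inner_harmL2_toLp {f : S2 → ℂ} (hf : MemLp f 2 surf) (i : HarmIndex) :
    inner ℂ (harmL2 i) (hf.toLp f) = ip f (harmC i) := by
  rw [L2.inner_def]
  refine integral_congr_ae ?_
  filter_upwards [hf.coeFn_toLp, ContinuousMap.coeFn_toLp (p := 2) (𝕜 := ℂ) surf (harmC i)]
    with u h1 h2
  rw [harmL2, h1, h2]
  rfl

lemma hasSum_sq_norm_inner_harmL2 (v : L2S) :
    HasSum (fun i => ‖inner ℂ (harmL2 i) v‖ ^ 2) (‖v‖ ^ 2) := by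
  have h := harmBasis.hasSum_inner_mul_inner v v
  rw [coe_harmBasis] at h
  have h2 := Complex.hasSum_re h
  convert h2 using 1
  · ext i
    rw [← inner_conj_symm v, mul_comm, Complex.mul_conj']
    norm_cast
  · rw [inner_self_eq_norm_sq_to_K]
    norm_cast

/-- The error of the `M`-th partial expansion of `f` as an element of `L²(𝕊²)`, with its
coefficients in the basis of spherical harmonics. -/
lemma exists_expansion_error (hα : ∀ l : ℕ, 𝓕 α ((l : ℝ) / t J) ≠ 0 → 2 * l ≤ t J)
    (hβ : ∀ (s : Fin n) (j : ℤ), J ≤ j → ∀ l : ℕ, 𝓕 (β s) ((l : ℝ) / t j) ≠ 0 →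
      2 * l ≤ t (j + 1))
    (hx : ∀ j, J ≤ j → IsSphericalDesign (t j) (x j))
    {f : S2 → ℂ} (hf : MemLp f 2 surf) (M : ℕ) :
    ∃ D : L2S, eLpNorm (fun u => f u -
        partialExpansion α β t (fun j => equalWeightRule (x j)) J f M u) 2 surf
          = ENNReal.ofReal ‖D‖ ∧
      ∀ i, inner ℂ (harmL2 i) D = (1 - expansionMultiplier α β t J M i.1 : ℂ) * ip f (harmC i) := by
  classical
  obtain ⟨L, hL, hsum⟩ := partialExpansion_eq_sum hα hβ hx hf M
  let P : C(S2, ℂ) := ∑ i ∈ indexBelow L,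
    ((expansionMultiplier α β t J M i.1 : ℂ) * ip f (harmC i)) • harmC i
  refine ⟨hf.toLp f - ContinuousMap.toLp 2 surf ℂ P, ?_, fun i => ?_⟩
  · rw [Lp.norm_def, ENNReal.ofReal_toReal (Lp.eLpNorm_ne_top _)]
    refine eLpNorm_congr_ae ?_
    filter_upwards [Lp.coeFn_sub (hf.toLp f) (ContinuousMap.toLp 2 surf ℂ P), hf.coeFn_toLp,
      ContinuousMap.coeFn_toLp (p := 2) (𝕜 := ℂ) surf P] with u h1 h2 h3
    rw [h1, Pi.sub_apply, h2, h3, hsum]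
    simp [P, ContinuousMap.sum_apply]
  · have h (i' : HarmIndex) : inner ℂ (harmL2 i) (ContinuousMap.toLp 2 surf ℂ (harmC i'))
        = if i = i' then (1 : ℂ) else 0 := orthonormal_iff_ite.1 orthonormal_harmL2 i i'
    rw [inner_sub_right, inner_harmL2_toLp, map_sum, inner_sum]
    simp only [map_smul, inner_smul_right, h, mul_ite, mul_one, mul_zero, Finset.sum_ite_eq,
      mem_indexBelow]
    split_ifs with hi
    · ring
    · rw [hL i.1 (by omega)]
      simp

/-- Testing on `Y_l^0` forces the limit in degree `l`. Conversely the multipliers increase to `1`,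
hence lie in `[0, 1]`; the Parseval series of the error is dominated by that of `f` and tends to
zero termwise. -/
lemma isTightFrameletSystem_iff (hα : ∀ l : ℕ, 𝓕 α ((l : ℝ) / t J) ≠ 0 → 2 * l ≤ t J)
    (hβ : ∀ (s : Fin n) (j : ℤ), J ≤ j → ∀ l : ℕ, 𝓕 (β s) ((l : ℝ) / t j) ≠ 0 →
      2 * l ≤ t (j + 1))
    (hx : ∀ j, J ≤ j → IsSphericalDesign (t j) (x j)) :
    IsTightFrameletSystem α β t (fun j => equalWeightRule (x j)) J ↔
      ∀ l, Tendsto (fun M => expansionMultiplier α β t J M l) atTop (𝓝 1) := by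
  constructor
  · intro H l
    let i : HarmIndex := ⟨l, 0, by simp⟩
    have hf := memLp_continuousMap (harmC i)
    have H := H _ hf
    choose D hD hDi using exists_expansion_error hα hβ hx hf
    simp only [hD] at H
    have H := (ENNReal.tendsto_toReal ENNReal.zero_ne_top).comp H
    simp only [Function.comp_def, ENNReal.toReal_ofReal (norm_nonneg _),
      ENNReal.toReal_zero] at H
    rw [tendsto_iff_norm_sub_tendsto_zero]
    refine squeeze_zero (fun _ => norm_nonneg _) (fun M => ?_) H
    have h1 : ip (harmC i) (harmC i) = 1 := by
      rw [ip, integral_harmC_mul_conj, if_pos rfl]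
    have h2 := norm_inner_le_norm (𝕜 := ℂ) (harmL2 i) (D M)
    rw [hDi, h1, orthonormal_harmL2.1 i, one_mul, mul_one] at h2
    rw [norm_sub_rev]
    exact_mod_cast h2
  · intro H f hf
    choose D hD hDi using exists_expansion_error hα hβ hx hf
    simp only [hD]
    rw [← ENNReal.ofReal_zero]
    refine ENNReal.tendsto_ofReal ?_
    suffices h : Tendsto (fun M => ‖D M‖ ^ 2) atTop (𝓝 0) by
      have := (Real.continuous_sqrt.tendsto 0).comp h
      simpa [Function.comp_def, Real.sqrt_sq (norm_nonneg _)] using this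
    have hnorm (M : ℕ) : ‖D M‖ ^ 2 = ∑' i : HarmIndex,
        (1 - expansionMultiplier α β t J M i.1) ^ 2 * ‖ip f (harmC i)‖ ^ 2 := by
      rw [← (hasSum_sq_norm_inner_harmL2 (D M)).tsum_eq]
      refine tsum_congr fun i => ?_
      rw [hDi, norm_mul, mul_pow]
      congr 1
      rw [← Complex.ofReal_one, ← Complex.ofReal_sub, Complex.norm_real, Real.norm_eq_abs, sq_abs]
    have hsummable : Summable fun i : HarmIndex => ‖ip f (harmC i)‖ ^ 2 := by
      simpa only [inner_harmL2_toLp] using (hasSum_sq_norm_inner_harmL2 (hf.toLp f)).summable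
    simp only [hnorm]
    have hzero : (0 : ℝ) = ∑' _ : HarmIndex, (0 : ℝ) := tsum_zero.symm
    rw [hzero]
    refine tendsto_tsum_of_dominated_convergence hsummable (fun i => ?_)
      (Eventually.of_forall fun M i => ?_)
    · simpa using (((H i.1).const_sub 1).pow 2).mul_const (‖ip f (harmC i)‖ ^ 2)
    · have h0 : 0 ≤ expansionMultiplier α β t J M i.1 := expansionMultiplier_nonneg _ _
      have h1 : expansionMultiplier α β t J M i.1 ≤ 1 :=
        (expansionMultiplier_monotone i.1).ge_of_tendsto (H i.1) M
      rw [Real.norm_of_nonneg (by positivity)]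
      exact mul_le_of_le_one_left (by positivity) (pow_le_one₀ (by linarith) (by linarith))

end Expansion

/-! ### Relations between scales and the equivalences -/

lemma two_mul_le_of_fourier_ne_zero {g : ℝ → ℂ}
    (hsupp : tsupport (𝓕 g : ℝ → ℂ) ∩ Set.Ici 0 ⊆ Set.Icc 0 (1 / 2)) {T : ℕ} (hT : 0 < T) {l : ℕ}
    (h : 𝓕 g ((l : ℝ) / T) ≠ 0) : 2 * l ≤ T := by
  have h1 := (hsupp ⟨subset_tsupport _ h, show (0 : ℝ) ≤ (l : ℝ) / T by positivity⟩).2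
  rw [div_le_div_iff₀ (by positivity) two_pos] at h1
  have h2 : (l : ℝ) * 2 ≤ T := by simpa using h1
  exact_mod_cast (mul_comm (2 : ℝ) l).trans_le h2

/-- Expansions from `J` and from `J + 1` ending at the same scale share all their later terms. If
both multipliers tend to `1`, what remains is the two-scale identity. -/
lemma expansionMultiplier_succ {n : ℕ} (α : ℝ → ℂ) (β : Fin n → ℝ → ℂ) (t : ℤ → ℕ) (J : ℤ)
    (M l : ℕ) :
    expansionMultiplier α β t J (M + 1) l + ‖𝓕 α ((l : ℝ) / t (J + 1))‖ ^ 2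
      = expansionMultiplier α β t (J + 1) M l + (‖𝓕 α ((l : ℝ) / t J)‖ ^ 2
        + ∑ s, ‖𝓕 (β s) ((l : ℝ) / t J)‖ ^ 2) := by
  simp only [expansionMultiplier, Finset.sum_range_succ', Nat.cast_zero, add_zero]
  have h (i : ℕ) : J + ((i + 1 : ℕ) : ℤ) = J + 1 + i := by push_cast; ring
  simp only [h]
  ring

lemma expansionMultiplier_eq_sq_norm {n : ℕ} {α : ℝ → ℂ} {β : Fin n → ℝ → ℂ} {t : ℤ → ℕ} {J : ℤ}
    {l : ℕ} (h : ∀ j, J ≤ j → ‖𝓕 α ((l : ℝ) / t (j + 1))‖ ^ 2 =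
      ‖𝓕 α ((l : ℝ) / t j)‖ ^ 2 + ∑ s, ‖𝓕 (β s) ((l : ℝ) / t j)‖ ^ 2) (M : ℕ) :
    expansionMultiplier α β t J M l = ‖𝓕 α ((l : ℝ) / t (J + M))‖ ^ 2 := by
  induction M with
  | zero => simp [expansionMultiplier]
  | succ M ih =>
    have h1 : J + ((M + 1 : ℕ) : ℤ) = J + M + 1 := by push_cast; ring
    rw [h1, h _ (by omega), ← ih]
    simp only [expansionMultiplier, Finset.sum_range_succ]
    ring

end SphFramelet

end

theorem mainTheorem5 (n : ℕ) (α : ℝ → ℂ) (β : Fin n → ℝ → ℂ) (a : ℤ → ℂ) (b : Fin n → ℤ → ℂ)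
    (hα : Integrable α) (hβ : ∀ s, Integrable (β s))
    (ha : Summable fun k => ‖a k‖) (hb : ∀ s, Summable fun k => ‖b s k‖)
    (hsupp : tsupport (𝓕 α : ℝ → ℂ) ∩ Set.Ici 0 ⊆ Set.Icc 0 (1 / 2))
    (hrefα : ∀ ξ : ℝ, 𝓕 α (2 * ξ) = SphFramelet.filterHat a ξ * 𝓕 α ξ)
    (hrefβ : ∀ (s : Fin n) (ξ : ℝ), 𝓕 (β s) (2 * ξ) = SphFramelet.filterHat (b s) ξ * 𝓕 α ξ)
    (J₀ : ℤ) (t : ℤ → ℕ) (ht_pos : ∀ j, J₀ ≤ j → 0 < t j)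
    (ht_double : ∀ j, J₀ ≤ j → t (j + 1) = 2 * t j)
    (N : ℤ → ℕ) (x : (j : ℤ) → Fin (N j) → SphFramelet.S2)
    (hx : ∀ j, J₀ ≤ j → SphFramelet.IsSphericalDesign (t j) (x j)) :
    List.TFAE [
      ∀ J : ℤ, J₀ ≤ J → SphFramelet.IsTightFrameletSystem α β t
        (fun j => SphFramelet.equalWeightRule (x j)) J,
      SphFramelet.LimitCondition α t ∧
        ∀ (l : ℕ) (j : ℤ), J₀ ≤ j →
          ‖𝓕 α ((l : ℝ) / (t (j + 1) : ℝ))‖ ^ 2 =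
            ‖𝓕 α ((l : ℝ) / (t j : ℝ))‖ ^ 2 +
              ∑ s, ‖𝓕 (β s) ((l : ℝ) / (t j : ℝ))‖ ^ 2,
      SphFramelet.LimitCondition α t ∧
        ∀ (l : ℕ) (j : ℤ), J₀ + 1 ≤ j → 𝓕 α ((l : ℝ) / (t j : ℝ)) ≠ 0 →
          ‖SphFramelet.filterHat a ((l : ℝ) / (t j : ℝ))‖ ^ 2 +
            ∑ s, ‖SphFramelet.filterHat (b s) ((l : ℝ) / (t j : ℝ))‖ ^ 2 = 1] := by

  have hA (j : ℤ) (hj : J₀ ≤ j) (l : ℕ) (h : 𝓕 α ((l : ℝ) / t j) ≠ 0) : 2 * l ≤ t j :=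
    SphFramelet.two_mul_le_of_fourier_ne_zero hsupp (ht_pos j hj) h
  have hscale (j : ℤ) (hj : J₀ ≤ j) (l : ℕ) : (l : ℝ) / t j = 2 * ((l : ℝ) / t (j + 1)) := by
    have := ht_pos j hj
    rw [ht_double j hj]
    push_cast
    field_simp
  have hB (s : Fin n) (j : ℤ) (hj : J₀ ≤ j) (l : ℕ) (h : 𝓕 (β s) ((l : ℝ) / t j) ≠ 0) :
      2 * l ≤ t (j + 1) := by
    rw [hscale j hj, hrefβ] at h
    exact hA (j + 1) (by omega) l (right_ne_zero_of_mul h)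
  have htight (J : ℤ) (hJ : J₀ ≤ J) := SphFramelet.isTightFrameletSystem_iff (hA J hJ)
    (fun s j hj => hB s j (hJ.trans hj)) (fun j hj => hx j (hJ.trans hj))
  tfae_have 1 → 2 := by
    intro H
    have hrefine (l : ℕ) (j : ℤ) (hj : J₀ ≤ j) : ‖𝓕 α ((l : ℝ) / (t (j + 1) : ℝ))‖ ^ 2 =
        ‖𝓕 α ((l : ℝ) / (t j : ℝ))‖ ^ 2 + ∑ s, ‖𝓕 (β s) ((l : ℝ) / (t j : ℝ))‖ ^ 2 := by
      have h1 := ((tendsto_add_atTop_iff_nat 1).2 ((htight j hj).1 (H j hj) l)).add_const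
        (‖𝓕 α ((l : ℝ) / (t (j + 1) : ℝ))‖ ^ 2)
      have h2 := ((htight (j + 1) (by omega)).1 (H (j + 1) (by omega)) l).add_const
        (‖𝓕 α ((l : ℝ) / (t j : ℝ))‖ ^ 2 + ∑ s, ‖𝓕 (β s) ((l : ℝ) / (t j : ℝ))‖ ^ 2)
      simp only [SphFramelet.expansionMultiplier_succ] at h1
      exact add_left_cancel (tendsto_nhds_unique h1 h2)
    refine ⟨fun l => ?_, hrefine⟩
    have h1 := (htight J₀ le_rfl).1 (H J₀ le_rfl) l
    simp only [SphFramelet.expansionMultiplier_eq_sq_norm (hrefine l)] at h1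
    have h2 := (Real.continuous_sqrt.tendsto 1).comp h1
    simp only [Function.comp_def, Real.sqrt_sq (norm_nonneg _), Real.sqrt_one] at h2
    -- The limit is known along `J₀ + M` with `M` natural; this transfers it to integers `j → ∞`.
    have h3 : Tendsto (fun j : ℤ => (j - J₀).toNat) atTop atTop := by
      refine tendsto_atTop.2 fun k => ?_
      filter_upwards [eventually_ge_atTop (J₀ + k)] with j hj
      omega
    refine (h2.comp h3).congr' ?_
    filter_upwards [eventually_ge_atTop J₀] with j hj
    have : J₀ + ((j - J₀).toNat : ℤ) = j := by omega
    simp only [Function.comp_apply, this]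
  tfae_have 2 → 1 := by
    rintro ⟨hlim, hrefine⟩ J hJ
    refine (htight J hJ).2 fun l => ?_
    simp only [SphFramelet.expansionMultiplier_eq_sq_norm fun j hj => hrefine l j (hJ.trans hj)]
    have h3 : Tendsto (fun M : ℕ => J + (M : ℤ)) atTop atTop :=
      tendsto_atTop_add_const_left _ _ tendsto_natCast_atTop_atTop
    simpa using ((hlim l).comp h3).pow 2
  tfae_have 2 ↔ 3 := by
    refine and_congr_right fun _ => ?_
    have key (l : ℕ) (j : ℤ) (hj : J₀ ≤ j) :
        ‖𝓕 α ((l : ℝ) / t j)‖ ^ 2 + ∑ s, ‖𝓕 (β s) ((l : ℝ) / t j)‖ ^ 2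
          = (‖SphFramelet.filterHat a ((l : ℝ) / t (j + 1))‖ ^ 2 +
            ∑ s, ‖SphFramelet.filterHat (b s) ((l : ℝ) / t (j + 1))‖ ^ 2) *
              ‖𝓕 α ((l : ℝ) / t (j + 1))‖ ^ 2 := by
      rw [hscale j hj]
      simp only [hrefα, hrefβ, norm_mul, mul_pow, add_mul, Finset.sum_mul]
    constructor
    · intro H l j hj hne
      -- The filter identity at scale `j` is the two-scale identity from `j - 1` to `j`, which is
      -- why (iii) begins at `J₀ + 1`.
      obtain ⟨i, rfl⟩ : ∃ i, j = i + 1 := ⟨j - 1, by ring⟩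
      have h := H l i (by omega)
      rw [key l i (by omega)] at h
      have h0 : ‖𝓕 α ((l : ℝ) / t (i + 1))‖ ^ 2 ≠ 0 := pow_ne_zero 2 (norm_ne_zero_iff.2 hne)
      exact mul_right_cancel₀ h0 (by rw [← h, one_mul])
    · intro H l j hj
      rw [key l j hj]
      by_cases h : 𝓕 α ((l : ℝ) / t (j + 1)) = 0
      · simp [h]
      · rw [H l (j + 1) (by omega) h, one_mul]
  tfae_finish
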